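/- Let $\Gamma=(V,E)$ be a connected, finite, simple graph on $N\ge 3$ vertices. Let $\lambda_1\le\dots\le\lambda_N$ be the eigenvalues of its normalized Laplacian, the operator on functions $f:V\to\mathbb{R}$ given by $\Delta f(v)=f(v)-\frac{1}{\deg v}\sum_{w\sim v}f(w)$, and let $\varepsilon:=\min_i|1-\lambda_i|$. Then $$\varepsilon\le\tfrac12 .$$ Moreover, $\varepsilon=\frac12$ if and only if, up to isomorphism, either $N$ is odd and $\Gamma$ is a petal graph, or $N$ is even and $\Gamma$ is a book graph. Here, for $m\ge1$, the $m$-petal graph (friendship graph) has the $2m+1$ vertices $x,v_1,\dots,v_m,w_1,\dots,w_m$ and the edges $xv_i$, $xw_i$, $v_iw_i$ ($1\le i\le m$), and the $m$-book graph has the $2m+2$ vertices $x,y,v_1,\dots,v_m,w_1,\dots,w_m$ and the edges $xv_i$, $yw_i$, $v_iw_i$ ($1\le i\le m$). Call a nonempty open interval $I\subseteq\mathbb{R}$ a gap interval for connected graphs if there are infinitely many pairwise non-isomorphic connected finite simple graphs none of whose normalized Laplacian eigenvalues lies in $I$. Then $(\frac12,\frac32)$ is a maximal gap interval for connected graphs: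 it is a gap interval, and no open interval that properly contains it is one. -/

import Mathlib

/-- The normalized Laplacian of a finite graph, acting on real functions on the vertices:
`Δ f (v) = f v - (1 / deg v) * ∑_{w ∼ v} f w`. -/
noncomputable def normalizedLaplacian {V : Type*} [Fintype V] (G : SimpleGraph V)
    [DecidableRel G.Adj] : Module.End ℝ (V → ℝ) where
  toFun f v := f v - 1 / (G.degree v : ℝ) * ∑ w ∈ G.neighborFinset v, f w
  map_add' f g := by
    funext v
    simp only [Pi.add_apply, Finset.sum_add_distrib]
    ring
  map_smul' c f := by
    funext v
    simp only [Pi.smul_apply, smul_eq_mul, ← Finset.mul_sum, RingHom.id_apply]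
    ring

/-- The set of eigenvalues of the normalized Laplacian. -/
def laplacianSpectrum {V : Type*} [Fintype V] (G : SimpleGraph V) [DecidableRel G.Adj] :
    Set ℝ :=
  {μ | (normalizedLaplacian G).HasEigenvalue μ}

/-- The distances `|1 - λ|` from `1` of the eigenvalues `λ` of the normalized Laplacian. -/
def distancesFromOne {V : Type*} [Fintype V] (G : SimpleGraph V) [DecidableRel G.Adj] :
    Set ℝ :=
  (fun μ : ℝ => |1 - μ|) '' laplacianSpectrum G

/-- The spectral gap from `1`, `ε = min_i |1 - λ_i|`. -/
noncomputable def spectralGapFromOne {V : Type*} [Fintype V] (G : SimpleGraph V)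
    [DecidableRel G.Adj] : ℝ :=
  sInf (distancesFromOne G)

/-- The `m`-petal graph, on the `2 m + 1` vertices `x`, `v_i`, `w_i` (in this order in the sum
type), with edges `x v_i`, `x w_i` and `v_i w_i`. -/
def petalGraph (m : ℕ) : SimpleGraph (Unit ⊕ (Fin m ⊕ Fin m)) :=
  SimpleGraph.fromEdgeSet
    (Set.range (fun i : Fin m => s(Sum.inl (), Sum.inr (Sum.inl i))) ∪
      Set.range (fun i : Fin m => s(Sum.inl (), Sum.inr (Sum.inr i))) ∪
      Set.range (fun i : Fin m => s(Sum.inr (Sum.inl i), Sum.inr (Sum.inr i))))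

/-- The `m`-book graph, on the `2 m + 2` vertices `x`, `y` (`Sum.inl 0` and `Sum.inl 1`), `v_i`,
`w_i`, with edges `x v_i`, `y w_i` and `v_i w_i`. -/
def bookGraph (m : ℕ) : SimpleGraph (Fin 2 ⊕ (Fin m ⊕ Fin m)) :=
  SimpleGraph.fromEdgeSet
    (Set.range (fun i : Fin m => s(Sum.inl 0, Sum.inr (Sum.inl i))) ∪
      Set.range (fun i : Fin m => s(Sum.inl 1, Sum.inr (Sum.inr i))) ∪
      Set.range (fun i : Fin m => s(Sum.inr (Sum.inl i), Sum.inr (Sum.inr i))))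

/-- `G` is (isomorphic to) an `m`-petal graph for some `m ≥ 1`. -/
def IsPetalGraph {V : Type*} (G : SimpleGraph V) : Prop :=
  ∃ m : ℕ, 1 ≤ m ∧ Nonempty (G ≃g petalGraph m)

/-- `G` is (isomorphic to) an `m`-book graph for some `m ≥ 1`. -/
def IsBookGraph {V : Type*} (G : SimpleGraph V) : Prop :=
  ∃ m : ℕ, 1 ≤ m ∧ Nonempty (G ≃g bookGraph m)

/-- Finite simple graphs, with vertex set `{0, …, n - 1}`; every finite simple graph is isomorphic
to one of these. -/
abbrev FiniteGraph : Type := Σ n : ℕ, SimpleGraph (Fin n)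

/-- The family of connected finite graphs. -/
def connectedGraphs : Set FiniteGraph := {Γ | Γ.2.Connected}

open Classical in
/-- `I` is a gap interval for the family `𝒢`: a nonempty open interval, bounded or not, such that
there are infinitely many pairwise non-isomorphic graphs in `𝒢` whose Laplacian spectrum does not
meet `I`. -/
def IsGapInterval (𝒢 : Set FiniteGraph) (I : Set ℝ) : Prop :=
  IsOpen I ∧ I.OrdConnected ∧ I.Nonempty ∧
    ∃ S : Set FiniteGraph, S ⊆ 𝒢 ∧ S.Infinite ∧
      S.Pairwise (fun Γ Γ' => IsEmpty (Γ.2 ≃g Γ'.2)) ∧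
      ∀ Γ ∈ S, Disjoint (laplacianSpectrum Γ.2) I

/-!
Let `P = 1 - Δ` be the transition operator, which is self-adjoint for the inner product weighted by
the degrees. All eigenvalues of `Δ` have distance at least `½` from `1` exactly when `P² - ¼` is
nonnegative, that is, when
`∑ v, (1 / deg v) (∑_{w ∼ v} f w)² ≥ ¼ ∑ v, deg v (f v)²` for all `f`.
Everything follows once this inequality is known to force a petal graph or a book graph
(`HasWideGap.isPetalGraph_or_isBookGraph`): these have gap exactly `½`, so no gap exceeds `½`, and
as they contain the eigenvalues `½` and `3/2` (apart from the triangle, which lacks `½`), no larger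
interval is a gap interval.

The classification is local. The `2 × 2` minor of the form at two vertices `u ≠ v` with a common
neighbour `w` gives `h u * h v ≥ (1 / deg w)²`, where `h u = ∑_{y ∼ u} (1 / deg y - ¼)`. Only
neighbours of degree at most three contribute positively to `h`, so small degrees abound, and a
small `h u` forces large degrees at distance two. Leaves are eliminated beforehand: each vertex has
at most one, and minimizing over the values at the leaves replaces the weight `1 / deg` of their
support vertices by a negative one (`HasWideGap.reduced_nonneg`). After that, on a path `u, y, z, v`
whose inner vertices have degree two, `h y = 1 / deg u` and `h v ≤ deg v / 4`, hence
`deg u ≤ deg v`; by symmetry there is equality, which means that all neighbours of `u` have degree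
two (`HasWideGap.isOrdinaryTwo_of_path`). A few further degree combinations are excluded in the same
way, and there remains a hub, a vertex whose neighbours have degree two and lead on to vertices of
degree two (`HasWideGap.exists_isHub`), unless two support vertices of leaves are adjacent and the
graph is a path on four vertices. For two neighbours `u₁`, `u₂` of a hub the `2 × 2` minor vanishes,
so `δ_{u₁} - δ_{u₂}` is in the kernel of the form, and this makes all paths of length three from the
hub end at one and the same vertex (`HasWideGap.exists_of_isHub`).
-/

/-! ### The two-step form -/

section TwoStepForm

variable {V : Type*} [Fintype V] (G : SimpleGraph V) [DecidableRel G.Adj]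

/-- The symmetric bilinear form `∑ v, κ v (∑_{w ∼ v} f w) (∑_{w ∼ v} g w) - ¼ ∑ v, deg v f v g v`.
For `κ = 1 / deg` it is the form of `P² - ¼` in the inner product weighted by the degrees, where
`P = 1 - Δ` is the transition operator. -/
noncomputable def twoStepForm (κ f g : V → ℝ) : ℝ :=
  ∑ v, κ v * (∑ w ∈ G.neighborFinset v, f w) * (∑ w ∈ G.neighborFinset v, g w) -
    ∑ v, (G.degree v : ℝ) / 4 * f v * g v

variable {G}

lemma twoStepForm_combination (κ f g : V → ℝ) (a b : ℝ) :
    twoStepForm G κ (a • f + b • g) (a • f + b • g) =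
      a ^ 2 * twoStepForm G κ f f + 2 * (a * b) * twoStepForm G κ f g +
        b ^ 2 * twoStepForm G κ g g := by
  simp only [twoStepForm, Pi.add_apply, Pi.smul_apply, smul_eq_mul, Finset.sum_add_distrib,
    ← Finset.mul_sum, mul_sub]
  simp only [Finset.mul_sum (s := Finset.univ)]
  rw [show ∀ p q r s t u : ℝ, p - q + (r - s) + (t - u) = (p + r + t) - (q + s + u) by
    intros; ring]
  simp only [← Finset.sum_add_distrib]
  congr 1 <;> refine Finset.sum_congr rfl fun v _ => ?_ <;> ring

lemma twoStepForm_sub_left (κ f f' g : V → ℝ) :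
    twoStepForm G κ (f - f') g = twoStepForm G κ f g - twoStepForm G κ f' g := by
  simp only [twoStepForm, Pi.sub_apply, Finset.sum_sub_distrib, mul_sub, sub_mul]
  ring

lemma twoStepForm_comm (κ f g : V → ℝ) : twoStepForm G κ f g = twoStepForm G κ g f := by
  unfold twoStepForm
  congr 1 <;> refine Finset.sum_congr rfl fun v _ => ?_ <;> ring

/-- The Cauchy-Schwarz inequality on a subspace where the form is nonnegative. -/
lemma twoStepForm_sq_le {κ : V → ℝ} {W : Submodule ℝ (V → ℝ)}
    (hW : ∀ f ∈ W, 0 ≤ twoStepForm G κ f f) {f g : V → ℝ} (hf : f ∈ W) (hg : g ∈ W) :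
    twoStepForm G κ f g ^ 2 ≤ twoStepForm G κ f f * twoStepForm G κ g g := by
  have h : ∀ t : ℝ, 0 ≤ twoStepForm G κ f f * (t * t) + 2 * twoStepForm G κ f g * t +
      twoStepForm G κ g g := by
    intro t
    have := hW _ (W.add_mem (W.smul_mem t hf) (W.smul_mem 1 hg))
    rw [twoStepForm_combination] at this
    linarith
  have := discrim_le_zero h
  unfold discrim at this
  linarith

variable (G) in
/-- The diagonal value `∑_{y ∼ u} κ y - ¼ deg u` of the two-step form at the vertex `u`. -/
noncomputable def excess (κ : V → ℝ) (u : V) : ℝ :=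
  ∑ y ∈ G.neighborFinset u, κ y - (G.degree u : ℝ) / 4

variable [DecidableEq V]

variable (G) in
/-- The total weight of the common neighbours of `u` and `v`. -/
noncomputable def commonWeight (κ : V → ℝ) (u v : V) : ℝ :=
  ∑ y ∈ G.neighborFinset u ∩ G.neighborFinset v, κ y

lemma sum_neighborFinset_single (u v : V) :
    ∑ w ∈ G.neighborFinset v, (Pi.single u 1 : V → ℝ) w =
      if v ∈ G.neighborFinset u then 1 else 0 := by
  simp [G.adj_comm]

lemma twoStepForm_single_self (κ : V → ℝ) (u : V) :
    twoStepForm G κ (Pi.single u 1) (Pi.single u 1) = excess G κ u := by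
  simp only [twoStepForm, excess, sum_neighborFinset_single]
  congr 1
  · simp [← Finset.sum_filter]
    congr 1; ext; simp
  · rw [Finset.sum_eq_single u] <;> simp +contextual

lemma twoStepForm_single_of_ne (κ : V → ℝ) {u v : V} (h : u ≠ v) :
    twoStepForm G κ (Pi.single u 1) (Pi.single v 1) = commonWeight G κ u v := by
  simp only [twoStepForm, commonWeight, sum_neighborFinset_single]
  rw [Finset.sum_eq_zero (s := Finset.univ) (f := fun x => (G.degree x : ℝ) / 4 *
    (Pi.single u 1 : V → ℝ) x * (Pi.single v 1 : V → ℝ) x), sub_zero]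
  · rw [← Finset.sum_filter_add_sum_filter_not Finset.univ
      (fun y => y ∈ G.neighborFinset u ∩ G.neighborFinset v)]
    rw [Finset.sum_eq_zero (s := Finset.univ.filter fun y =>
      ¬ y ∈ G.neighborFinset u ∩ G.neighborFinset v), add_zero]
    · rw [Finset.filter_univ_mem]
      refine Finset.sum_congr rfl fun y hy => ?_
      rw [Finset.mem_inter] at hy
      simp only [if_pos hy.1, if_pos hy.2, mul_one]
    · intro y hy
      simp only [Finset.mem_filter, Finset.mem_inter, not_and_or] at hy
      rcases hy.2 with hy | hy <;> simp only [if_neg hy, mul_zero, zero_mul]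
  · intro y _
    by_cases hy : y = u
    · subst hy; simp [h]
    · simp [hy]

end TwoStepForm

/-! ### Elimination of the leaves -/

lemma SimpleGraph.Connected.mem_of_closed {V : Type*} {G : SimpleGraph V} (hG : G.Connected)
    {S : Set V} {x : V} (hx : x ∈ S) (hS : ∀ u ∈ S, ∀ v, G.Adj u v → v ∈ S) (v : V) : v ∈ S := by
  obtain ⟨p⟩ := hG.preconnected x v
  induction p with
  | nil => exact hx
  | cons h _ ih => exact ih (hS _ hx _ h)

section Leaves

variable {V : Type*} [Fintype V] (G : SimpleGraph V) [DecidableRel G.Adj]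

/-- Connected graphs on at least three vertices for which `(1 - Δ)² - ¼` is nonnegative, that is,
`|1 - λ| ≥ ½` for all eigenvalues `λ` of the Laplacian. -/
structure HasWideGap : Prop where
  connected : G.Connected
  three_le_card : 3 ≤ Fintype.card V
  form_nonneg : ∀ f, 0 ≤ twoStepForm G (fun v => 1 / (G.degree v : ℝ)) f f

/-- `v` is adjacent to a leaf. -/
def HasPendant (v : V) : Prop := ∃ l, G.Adj v l ∧ G.degree l = 1

open Classical in
/-- The weights of the two-step form that remains when the values at the leaves are chosen
optimally. At a vertex with a leaf they are `-1 / 2` for degree `2` and `-1` for degree `3`, the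
only two degrees that occur in `HasWideGap`; elsewhere they are `1 / deg`. -/
noncomputable def reducedWeight (v : V) : ℝ :=
  if HasPendant G v then (if G.degree v = 2 then -1 / 2 else -1) else 1 / (G.degree v : ℝ)

/-- The functions that vanish at all leaves. -/
def vanishingAtLeaves : Submodule ℝ (V → ℝ) where
  carrier := {f | ∀ v, G.degree v = 1 → f v = 0}
  add_mem' hf hg v hv := by simp [hf v hv, hg v hv]
  zero_mem' v _ := rfl
  smul_mem' c f hf v hv := by simp [hf v hv]

variable {G}

lemma neighborFinset_eq_singleton {l w : V} (hl : G.degree l = 1) (h : G.Adj l w) :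
    G.neighborFinset l = {w} := by
  obtain ⟨a, ha⟩ := Finset.card_eq_one.1 hl
  have : w ∈ G.neighborFinset l := by simpa using h
  rw [ha, Finset.mem_singleton] at this
  rw [ha, this]

lemma eq_of_adj_leaf {l w v : V} (hl : G.degree l = 1) (h : G.Adj l w) (h' : G.Adj l v) :
    v = w := by
  have : v ∈ G.neighborFinset l := by simpa using h'
  simpa [neighborFinset_eq_singleton hl h] using this

lemma neighborFinset_eq_pair [DecidableEq V] {y u z : V} (hy : G.degree y = 2) (hu : G.Adj y u)
    (hz : G.Adj y z) (huz : u ≠ z) : G.neighborFinset y = {u, z} := by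
  symm
  apply Finset.eq_of_subset_of_card_le
  · intro t ht
    rcases Finset.mem_insert.1 ht with rfl | ht
    · simpa using hu
    · rw [Finset.mem_singleton.1 ht]; simpa using hz
  · rw [Finset.card_pair huz, G.card_neighborFinset_eq_degree, hy]

lemma adj_iff_of_degree_two {y u z : V} (hy : G.degree y = 2) (hu : G.Adj y u)
    (hz : G.Adj y z) (huz : u ≠ z) (t : V) : G.Adj y t ↔ t = u ∨ t = z := by
  classical
  rw [← G.mem_neighborFinset, neighborFinset_eq_pair hy hu hz huz]
  simp

lemma exists_other_neighbor {y u : V} (hy : G.degree y ≠ 1) (hu : G.Adj y u) :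
    ∃ z, G.Adj y z ∧ z ≠ u := by
  have h1 : 0 < G.degree y := G.degree_pos_iff_exists_adj y |>.2 ⟨u, hu⟩
  have : 1 < (G.neighborFinset y).card := by rw [G.card_neighborFinset_eq_degree]; omega
  obtain ⟨z, hz, hne⟩ := Finset.exists_mem_ne this u
  exact ⟨z, by simpa using hz, hne⟩

lemma le_commonWeight [DecidableEq V] {κ : V → ℝ} {u v w : V}
    (hκ : ∀ y, G.Adj u y → G.Adj v y → 0 ≤ κ y) (hu : G.Adj u w) (hv : G.Adj v w) :
    κ w ≤ commonWeight G κ u v := by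
  refine Finset.single_le_sum (f := κ) (fun y hy => ?_) (by simp [hu, hv])
  simp only [Finset.mem_inter, SimpleGraph.mem_neighborFinset] at hy
  exact hκ y hy.1 hy.2

lemma degree_pos_of_connected (hG : G.Connected) (hN : 3 ≤ Fintype.card V) (v : V) :
    0 < G.degree v := by
  have : Nontrivial V := Fintype.one_lt_card_iff_nontrivial.1 (by omega)
  exact hG.preconnected.degree_pos_of_nontrivial v

namespace HasWideGap

lemma degree_pos (hG : HasWideGap G) (v : V) : 0 < G.degree v :=
  degree_pos_of_connected hG.connected hG.three_le_card v

lemma two_le_degree (hG : HasWideGap G) {v : V} (hv : G.degree v ≠ 1) : 2 ≤ G.degree v := by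
  have := hG.degree_pos v
  omega

lemma degree_ne_one_of_adj_leaf (hG : HasWideGap G) {l w : V} (hl : G.degree l = 1)
    (h : G.Adj w l) : G.degree w ≠ 1 := by
  classical
  intro hw
  have key : ∀ v, v ∈ ({l, w} : Set V) := by
    refine hG.connected.mem_of_closed (x := l) (by simp) ?_
    rintro u (rfl | rfl) v hv
    · right; exact eq_of_adj_leaf hl h.symm hv
    · left; exact eq_of_adj_leaf hw h hv
  have : Fintype.card V ≤ 2 := by
    rw [← Finset.card_univ]
    refine (Finset.card_le_card (t := {l, w}) fun v _ => ?_).trans Finset.card_le_two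
    simpa using key v
  have := hG.three_le_card
  omega

lemma sq_commonWeight_le [DecidableEq V] (hG : HasWideGap G) {u v : V} (huv : u ≠ v) :
    commonWeight G (fun v => 1 / (G.degree v : ℝ)) u v ^ 2 ≤
      excess G (fun v => 1 / (G.degree v : ℝ)) u * excess G (fun v => 1 / (G.degree v : ℝ)) v := by
  have := twoStepForm_sq_le (W := ⊤) (fun f _ => hG.form_nonneg f)
    (Submodule.mem_top (x := Pi.single u 1)) (Submodule.mem_top (x := Pi.single v 1))
  rwa [twoStepForm_single_self, twoStepForm_single_self, twoStepForm_single_of_ne _ huv] at this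

lemma excess_leaf {l w : V} (hl : G.degree l = 1) (h : G.Adj l w) :
    excess G (fun v => 1 / (G.degree v : ℝ)) l = 1 / G.degree w - 1 / 4 := by
  rw [excess, neighborFinset_eq_singleton hl h, hl]
  simp

/-- For a leaf `l` at a vertex `w` of degree `d`, the diagonal entry at `l` is `1 / d - 1 / 4`. It
must be positive because its row has a nonzero entry. -/
lemma degree_of_hasPendant (hG : HasWideGap G) {w : V} (hw : HasPendant G w) :
    G.degree w = 2 ∨ G.degree w = 3 := by
  classical
  obtain ⟨l, hwl, hl⟩ := hw
  have hw1 := hG.degree_ne_one_of_adj_leaf hl hwl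
  have hw2 := hG.two_le_degree hw1
  obtain ⟨u, hu, hul⟩ := exists_other_neighbor hw1 hwl
  have h := hG.sq_commonWeight_le hul.symm
  have hM := le_commonWeight (κ := fun v => 1 / (G.degree v : ℝ)) (fun y _ _ => by positivity)
    hwl.symm hu.symm
  have h0 : 0 ≤ excess G (fun v => 1 / (G.degree v : ℝ)) u := by
    rw [← twoStepForm_single_self]; exact hG.form_nonneg _
  have hpos : (0 : ℝ) < 1 / G.degree w := by
    have := hG.degree_pos w; positivity
  rw [excess_leaf hl hwl.symm] at h
  have h3 : (0 : ℝ) < 1 / G.degree w - 1 / 4 := by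
    by_contra hcon
    have := mul_nonneg (sub_nonneg.2 (not_lt.1 (sub_pos.not.1 hcon))) h0
    nlinarith [pow_pos (hpos.trans_le hM) 2]
  have h4 : (G.degree w : ℝ) < 4 := by
    by_contra hcon
    have : (1 : ℝ) / G.degree w ≤ 1 / 4 := one_div_le_one_div_of_le (by norm_num) (not_lt.1 hcon)
    linarith
  have : G.degree w < 4 := by exact_mod_cast h4
  omega

/-- Two leaves at the same vertex would give the eigenvalue `0` of the transition operator. -/
lemma leaf_unique (hG : HasWideGap G) {w l l' : V} (hl : G.degree l = 1) (hl' : G.degree l' = 1)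
    (h : G.Adj w l) (h' : G.Adj w l') : l = l' := by
  classical
  by_contra hne
  have hsq := hG.sq_commonWeight_le hne
  have hM := le_commonWeight (κ := fun v => 1 / (G.degree v : ℝ)) (fun y _ _ => by positivity)
    h.symm h'.symm
  rw [excess_leaf hl h.symm, excess_leaf hl' h'.symm] at hsq
  rcases hG.degree_of_hasPendant ⟨l, h, hl⟩ with hd | hd <;> rw [hd] at hM hsq <;>
    norm_num at hM hsq <;> nlinarith

open Classical in
lemma sum_leaf_neighbors (hG : HasWideGap G) (X : V → ℝ) (v : V) :
    ∑ l ∈ G.neighborFinset v, (if G.degree l = 1 then ∑ u ∈ G.neighborFinset l, X u else 0) =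
      if HasPendant G v then X v else 0 := by
  split_ifs with hv
  · obtain ⟨l, hvl, hl⟩ := hv
    rw [Finset.sum_eq_single l, if_pos hl, neighborFinset_eq_singleton hl hvl.symm,
      Finset.sum_singleton]
    · intro b hb hbl
      rw [if_neg]
      intro hb1
      exact hbl (hG.leaf_unique hb1 hl (by simpa using hb) hvl)
    · intro hl'; simp [hvl] at hl'
  · refine Finset.sum_eq_zero fun l hl => if_neg fun h => hv ⟨l, by simpa using hl, h⟩

lemma sum_neighborFinset_comm (F : V → V → ℝ) :
    ∑ v, ∑ u ∈ G.neighborFinset v, F v u = ∑ u, ∑ v ∈ G.neighborFinset u, F v u := by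
  refine Finset.sum_comm' fun v u => ?_
  simp [G.adj_comm]

open Classical in
/-- Substituting for the value at each leaf the multiple of the sum over the other neighbours of
its support vertex that minimizes the form turns the weights `1 / deg` into the reduced ones. -/
lemma reduced_nonneg (hG : HasWideGap G) :
    ∀ f ∈ vanishingAtLeaves G, 0 ≤ twoStepForm G (reducedWeight G) f f := by
  intro f hf
  -- the minimum over `t` of `(s + t)² / d - t² / 4` is at `t = -c s`
  set c : V → ℝ := fun v => if G.degree v = 2 then 2 else 4 with hc
  set s : V → ℝ := fun v => ∑ w ∈ G.neighborFinset v, f w with hs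
  set L : V → ℝ := fun l => if G.degree l = 1 then ∑ u ∈ G.neighborFinset l, c u * s u else 0
    with hL
  have h1 : ∀ v, ∑ w ∈ G.neighborFinset v, (f - L) w =
      s v - if HasPendant G v then c v * s v else 0 := by
    intro v
    simp only [Pi.sub_apply, Finset.sum_sub_distrib]
    rw [← hG.sum_leaf_neighbors (fun v => c v * s v) v]
  have h2 : ∑ v, (G.degree v : ℝ) / 4 * (f - L) v * (f - L) v =
      ∑ v, (G.degree v : ℝ) / 4 * f v * f v +
        ∑ v, (if HasPendant G v then (c v * s v) ^ 2 / 4 else 0) := by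
    have h3 : ∀ v, (if HasPendant G v then (c v * s v) ^ 2 / 4 else 0) = _ := fun v =>
      (hG.sum_leaf_neighbors (fun v => (c v * s v) ^ 2 / 4) v).symm
    simp only [h3]
    rw [show ∑ v, ∑ l ∈ G.neighborFinset v, (if G.degree l = 1 then
        ∑ u ∈ G.neighborFinset l, (c u * s u) ^ 2 / 4 else 0) =
        ∑ v, (G.degree v : ℝ) / 4 * L v * L v from ?_]
    · rw [← Finset.sum_add_distrib]
      refine Finset.sum_congr rfl fun v _ => ?_
      by_cases hv : G.degree v = 1
      · simp only [Pi.sub_apply, hf v hv]; ring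
      · simp [hL, hv]
    · rw [← sum_neighborFinset_comm
        (fun l _ => if G.degree l = 1 then ∑ u ∈ G.neighborFinset l, (c u * s u) ^ 2 / 4 else 0)]
      refine Finset.sum_congr rfl fun v _ => ?_
      by_cases hv : G.degree v = 1
      · obtain ⟨w, hw⟩ := (G.degree_pos_iff_exists_adj v).1 (hG.degree_pos v)
        simp only [hL, if_pos hv, neighborFinset_eq_singleton hv hw, Finset.sum_singleton]
        rw [hv]; push_cast; ring
      · simp [hL, hv]
  have key := hG.form_nonneg (f - L)
  unfold twoStepForm at key ⊢
  simp only [h1] at key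
  rw [h2, ← sub_sub, sub_right_comm, ← Finset.sum_sub_distrib] at key
  refine key.trans_eq ?_
  congr 1
  refine Finset.sum_congr rfl fun v _ => ?_
  change _ = reducedWeight G v * s v * s v
  by_cases hv : HasPendant G v
  · rcases hG.degree_of_hasPendant hv with hd | hd <;>
      simp only [if_pos hv, reducedWeight, hd, hc] <;> norm_num <;> ring
  · simp only [if_neg hv, reducedWeight]; ring

end HasWideGap

end Leaves

/-! ### Local analysis of the reduced form -/

section Reduced

variable {V : Type*} [Fintype V] (G : SimpleGraph V) [DecidableRel G.Adj]

/-- The diagonal of the reduced two-step form. It is nonnegative at all vertices that are not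
leaves, and at an ordinary vertex only neighbours of degree two and three contribute positively. -/
noncomputable def reducedExcess (u : V) : ℝ := excess G (reducedWeight G) u

/-- `v` is neither a leaf nor adjacent to a leaf. -/
structure IsOrdinary (v : V) : Prop where
  degree_ne_one : G.degree v ≠ 1
  not_hasPendant : ¬ HasPendant G v

/-- `v` is ordinary and has degree two. -/
structure IsOrdinaryTwo (v : V) : Prop extends IsOrdinary G v where
  degree_eq : G.degree v = 2

variable {G}

lemma IsOrdinary.neighbor_degree_ne_one {u y : V} (hu : IsOrdinary G u) (h : G.Adj u y) :
    G.degree y ≠ 1 := fun hy => hu.not_hasPendant ⟨y, h, hy⟩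

lemma IsOrdinary.reducedWeight_eq {v : V} (hv : IsOrdinary G v) :
    reducedWeight G v = 1 / (G.degree v : ℝ) := by
  rw [reducedWeight, if_neg hv.not_hasPendant]

lemma HasPendant.reducedWeight_le {v : V} (hv : HasPendant G v) :
    reducedWeight G v ≤ -1 / 2 := by
  rw [reducedWeight, if_pos hv]
  split_ifs <;> norm_num

lemma exists_neighborFinset_eq_triple [DecidableEq V] {w a b : V} (hw : G.degree w = 3)
    (ha : G.Adj w a) (hb : G.Adj w b) (hab : a ≠ b) :
    ∃ c, c ≠ a ∧ c ≠ b ∧ G.neighborFinset w = {a, b, c} := by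
  obtain ⟨c, hc, hca, hcb⟩ : ∃ c ∈ G.neighborFinset w, c ≠ a ∧ c ≠ b := by
    by_contra! hcon
    have : G.neighborFinset w ⊆ {a, b} := fun t ht => by
      by_cases h : t = a
      · simp [h]
      · simp [hcon t ht h]
    have := Finset.card_le_card this
    rw [G.card_neighborFinset_eq_degree, Finset.card_pair hab] at this
    omega
  refine ⟨c, hca, hcb, ?_⟩
  symm
  apply Finset.eq_of_subset_of_card_le
  · intro t ht
    simp only [Finset.mem_insert, Finset.mem_singleton] at ht
    rcases ht with rfl | rfl | rfl
    · simpa using ha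
    · simpa using hb
    · exact hc
  · rw [G.card_neighborFinset_eq_degree, hw,
      Finset.card_eq_three.2 ⟨a, b, c, hab, hca.symm, hcb.symm, rfl⟩]

lemma excess_of_neighborFinset_eq_pair [DecidableEq V] {κ : V → ℝ} {y u z : V} (huz : u ≠ z)
    (h : G.neighborFinset y = {u, z}) : excess G κ y = κ u + κ z - 1 / 2 := by
  rw [excess, ← G.card_neighborFinset_eq_degree, h, Finset.sum_pair huz, Finset.card_pair huz]
  norm_num

lemma excess_of_neighborFinset_eq_triple [DecidableEq V] {κ : V → ℝ} {y a b c : V} (hab : a ≠ b)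
    (hca : c ≠ a) (hcb : c ≠ b) (h : G.neighborFinset y = {a, b, c}) :
    excess G κ y = κ a + κ b + κ c - 3 / 4 := by
  rw [excess, ← G.card_neighborFinset_eq_degree, h,
    Finset.card_eq_three.2 ⟨a, b, c, hab, hca.symm, hcb.symm, rfl⟩,
    Finset.sum_insert (by simp [hab, hca.symm]), Finset.sum_pair hcb.symm]
  norm_num; ring

lemma excess_le {κ : V → ℝ} {u : V} {b : ℝ} (hb : ∀ y, G.Adj u y → κ y ≤ b) :
    excess G κ u ≤ G.degree u * b - G.degree u / 4 := by
  have := Finset.sum_le_card_nsmul (G.neighborFinset u) κ b (fun y hy => hb y (by simpa using hy))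
  rw [G.card_neighborFinset_eq_degree, nsmul_eq_mul] at this
  unfold excess
  linarith

lemma excess_le_of_neighbor {κ : V → ℝ} {u z : V} {b c : ℝ} (hb : ∀ y, G.Adj u y → κ y ≤ b)
    (hz : G.Adj u z) (hc : κ z ≤ c) :
    excess G κ u ≤ c + (G.degree u - 1) * b - G.degree u / 4 := by
  classical
  have hz' : z ∈ G.neighborFinset u := by simpa using hz
  have := Finset.sum_le_card_nsmul ((G.neighborFinset u).erase z) κ b
    (fun y hy => hb y (by simpa using Finset.mem_of_mem_erase hy))
  rw [nsmul_eq_mul, Finset.card_erase_of_mem hz', G.card_neighborFinset_eq_degree,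
    Nat.cast_sub (Nat.one_le_iff_ne_zero.2 (by
      rw [← G.card_neighborFinset_eq_degree]; exact Finset.card_ne_zero_of_mem hz'))] at this
  unfold excess
  rw [← Finset.add_sum_erase _ _ hz']
  push_cast at this
  linarith

lemma single_mem_vanishingAtLeaves {u : V} [DecidableEq V] (hu : G.degree u ≠ 1) :
    (Pi.single u 1 : V → ℝ) ∈ vanishingAtLeaves G := by
  intro v hv
  exact Pi.single_eq_of_ne (by rintro rfl; exact hu hv) _

lemma reducedWeight_le_inv {v : V} : reducedWeight G v ≤ 1 / (G.degree v : ℝ) := by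
  by_cases h : HasPendant G v
  · exact h.reducedWeight_le.trans (by linarith [show (0 : ℝ) ≤ 1 / G.degree v by positivity])
  · rw [reducedWeight, if_neg h]

lemma reducedWeight_le_of_le {v : V} {n : ℕ} (hn : 0 < n) (h : n ≤ G.degree v) :
    reducedWeight G v ≤ 1 / (n : ℝ) :=
  reducedWeight_le_inv.trans (one_div_le_one_div_of_le (by exact_mod_cast hn)
    (by exact_mod_cast h))

namespace HasWideGap

variable (hG : HasWideGap G)
include hG

lemma reducedExcess_nonneg {u : V} (hu : G.degree u ≠ 1) : 0 ≤ reducedExcess G u := by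
  classical
  rw [reducedExcess, ← twoStepForm_single_self]
  exact hG.reduced_nonneg _ (single_mem_vanishingAtLeaves hu)

lemma sq_reducedCommon_le [DecidableEq V] {u v : V} (hu : G.degree u ≠ 1) (hv : G.degree v ≠ 1)
    (huv : u ≠ v) :
    commonWeight G (reducedWeight G) u v ^ 2 ≤ reducedExcess G u * reducedExcess G v := by
  have := twoStepForm_sq_le hG.reduced_nonneg (single_mem_vanishingAtLeaves hu) (single_mem_vanishingAtLeaves hv)
  rwa [twoStepForm_single_self, twoStepForm_single_self, twoStepForm_single_of_ne _ huv] at this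

lemma reducedWeight_le_half {v : V} (hv : G.degree v ≠ 1) : reducedWeight G v ≤ 1 / 2 := by
  simpa using reducedWeight_le_of_le two_pos (hG.two_le_degree hv)

lemma reducedWeight_le_third {v : V} (hv : G.degree v ≠ 1) (h : ¬ IsOrdinaryTwo G v) :
    reducedWeight G v ≤ 1 / 3 := by
  by_cases hp : HasPendant G v
  · linarith [hp.reducedWeight_le]
  · have := hG.two_le_degree hv
    have h3 : 3 ≤ G.degree v := by
      by_contra hcon
      exact h ⟨⟨hv, hp⟩, by omega⟩
    simpa using reducedWeight_le_of_le three_pos h3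

lemma reducedWeight_leaf {l : V} (hl : G.degree l = 1) : reducedWeight G l = 1 := by
  rw [reducedWeight, if_neg, hl]
  · norm_num
  · rintro ⟨w, hw, hw1⟩
    exact hG.degree_ne_one_of_adj_leaf hw1 hw hl

lemma reducedExcess_le_quarter {u : V} (hu : IsOrdinary G u) :
    reducedExcess G u ≤ G.degree u / 4 := by
  have := excess_le (κ := reducedWeight G) (u := u) (b := 1 / 2)
    (fun y hy => hG.reducedWeight_le_half (hu.neighbor_degree_ne_one hy))
  unfold reducedExcess
  linarith

lemma reducedExcess_le_twelfth {u : V} (hu : IsOrdinary G u)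
    (h : ∀ y, G.Adj u y → ¬ IsOrdinaryTwo G y) : reducedExcess G u ≤ G.degree u / 12 := by
  have := excess_le (κ := reducedWeight G) (u := u) (b := 1 / 3)
    (fun y hy => hG.reducedWeight_le_third (hu.neighbor_degree_ne_one hy) (h y hy))
  unfold reducedExcess
  linarith

lemma reducedExcess_le_of_neighbor {u z : V} {c : ℝ} (hu : IsOrdinary G u) (hz : G.Adj u z)
    (hc : reducedWeight G z ≤ c) : reducedExcess G u ≤ c + G.degree u / 4 - 1 / 2 := by
  have := excess_le_of_neighbor (κ := reducedWeight G) (u := u) (b := 1 / 2)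
    (fun y hy => hG.reducedWeight_le_half (hu.neighbor_degree_ne_one hy)) hz hc
  unfold reducedExcess
  linarith

/-- Two adjacent support vertices of leaves have degree two, so that the graph is a path. -/
lemma degree_eq_two_of_adj_pendant {w t : V} (hw : HasPendant G w) (ht : HasPendant G t)
    (h : G.Adj w t) : G.degree w = 2 ∧ G.degree t = 2 := by
  classical
  have key : ∀ {w t : V}, HasPendant G w → HasPendant G t → G.Adj w t → G.degree w = 2 →
      G.degree t = 2 := by
    intro w t hw ht h hd
    have hw' := hw
    obtain ⟨l, hwl, hl⟩ := hw'
    have hw1 := hG.degree_ne_one_of_adj_leaf hl hwl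
    obtain ⟨l', htl', hl'⟩ := ht
    have ht1 := hG.degree_ne_one_of_adj_leaf hl' htl'
    have hlt : l ≠ t := by rintro rfl; exact ht1 hl
    have h0 := hG.reducedExcess_nonneg hw1
    rw [reducedExcess, excess_of_neighborFinset_eq_pair hlt (neighborFinset_eq_pair hd hwl h hlt),
      hG.reducedWeight_leaf hl, reducedWeight, if_pos ⟨l', htl', hl'⟩] at h0
    by_contra hcon
    rw [if_neg hcon] at h0
    norm_num at h0
  rcases hG.degree_of_hasPendant hw with hd | hd
  · exact ⟨hd, key hw ht h hd⟩
  rcases hG.degree_of_hasPendant ht with hd' | hd'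
  · exact ⟨key ht hw h.symm hd', hd'⟩
  exfalso
  obtain ⟨l, hwl, hl⟩ := hw
  have hw1 := hG.degree_ne_one_of_adj_leaf hl hwl
  have ht1 : G.degree t ≠ 1 := by omega
  have hlt : l ≠ t := by rintro rfl; exact ht1 hl
  obtain ⟨c, hcl, hct, hN⟩ := exists_neighborFinset_eq_triple hd hwl h hlt
  have hwc : G.Adj w c := by rw [← G.mem_neighborFinset, hN]; simp
  have hc1 : G.degree c ≠ 1 := fun hc => hcl (hG.leaf_unique hc hl hwc hwl)
  have h0 := hG.reducedExcess_nonneg hw1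
  have hκt : reducedWeight G t = -1 := by
    rw [reducedWeight, if_pos ht, if_neg (by omega)]
  rw [reducedExcess, excess_of_neighborFinset_eq_triple hlt hcl hct hN,
    hG.reducedWeight_leaf hl, hκt] at h0
  linarith [hG.reducedWeight_le_half hc1]

/-- The negative weight of a support vertex of a leaf is too large for a neighbour of degree at
most three. -/
lemma isOrdinary_of_adj {y w : V} (hy : IsOrdinary G y) (hd : G.degree y ≤ 3) (h : G.Adj y w) :
    IsOrdinary G w := by
  refine ⟨hy.neighbor_degree_ne_one h, fun hw => ?_⟩
  have h1 := hG.reducedExcess_le_of_neighbor hy h hw.reducedWeight_le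
  have h2 := hG.reducedExcess_nonneg hy.degree_ne_one
  have : (G.degree y : ℝ) ≤ 3 := by exact_mod_cast hd
  linarith

/-- The basic inequality: the Cauchy-Schwarz inequality for the ends of a path `y`, `w`, `v`. As
all neighbours of `y` are ordinary, no negative weight contributes to the mixed term. -/
lemma le_mul_reducedExcess {y w v : V} (hy : IsOrdinary G y) (hd : G.degree y ≤ 3)
    (hv : G.degree v ≠ 1) (hyv : y ≠ v) (hyw : G.Adj y w) (hwv : G.Adj w v) :
    (1 / (G.degree w : ℝ)) ^ 2 ≤ reducedExcess G y * reducedExcess G v := by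
  classical
  refine le_trans ?_ (hG.sq_reducedCommon_le hy.degree_ne_one hv hyv)
  have := le_commonWeight (κ := reducedWeight G) (fun t ht _ => by
    rw [(hG.isOrdinary_of_adj hy hd ht).reducedWeight_eq]; positivity) hyw hwv.symm
  rw [(hG.isOrdinary_of_adj hy hd hyw).reducedWeight_eq] at this
  exact pow_le_pow_left₀ (by positivity) this 2

lemma reducedExcess_pos {y : V} (hy : IsOrdinary G y) (hd : G.degree y ≤ 3) :
    0 < reducedExcess G y := by
  obtain ⟨w, hw⟩ := (G.degree_pos_iff_exists_adj y).1 (hG.degree_pos y)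
  have how := hG.isOrdinary_of_adj hy hd hw
  obtain ⟨v, hv, hvy⟩ := exists_other_neighbor how.degree_ne_one hw.symm
  have h := hG.le_mul_reducedExcess hy hd (how.neighbor_degree_ne_one hv) hvy.symm hw hv
  refine (hG.reducedExcess_nonneg hy.degree_ne_one).lt_of_ne fun h0 => ?_
  rw [← h0, zero_mul] at h
  have hpos : (0 : ℝ) < 1 / G.degree w := by
    have := hG.degree_pos w; positivity
  nlinarith

lemma reducedExcess_two {y u z : V} (hy : IsOrdinaryTwo G y) (hu : G.Adj y u) (hz : G.Adj y z)
    (huz : u ≠ z) :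
    reducedExcess G y = 1 / (G.degree u : ℝ) + 1 / (G.degree z : ℝ) - 1 / 2 := by
  classical
  have hd : G.degree y ≤ 3 := by have := hy.degree_eq; omega
  rw [reducedExcess,
    excess_of_neighborFinset_eq_pair huz (neighborFinset_eq_pair hy.degree_eq hu hz huz),
    (hG.isOrdinary_of_adj hy.toIsOrdinary hd hu).reducedWeight_eq,
    (hG.isOrdinary_of_adj hy.toIsOrdinary hd hz).reducedWeight_eq]

lemma isOrdinary_of_adj_two {y w : V} (hy : IsOrdinaryTwo G y) (h : G.Adj y w) :
    IsOrdinary G w :=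
  hG.isOrdinary_of_adj hy.toIsOrdinary (by have := hy.degree_eq; omega) h

lemma degree_le_of_path {u y z v : V} (hy : IsOrdinaryTwo G y) (hz : IsOrdinaryTwo G z)
    (hyz : G.Adj y z) (hyu : G.Adj y u) (huz : u ≠ z) (hzv : G.Adj z v) (hvy : v ≠ y) :
    (G.degree u : ℝ) / 4 ≤ reducedExcess G v := by
  have hv := hG.isOrdinary_of_adj_two hz hzv
  have h1 := hG.le_mul_reducedExcess hy.toIsOrdinary (by have := hy.degree_eq; omega)
    hv.degree_ne_one hvy.symm hyz hzv
  rw [hG.reducedExcess_two hy hyu hyz huz, hz.degree_eq] at h1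
  have hpos : (0 : ℝ) < G.degree u := by exact_mod_cast hG.degree_pos u
  have h2 : (1 : ℝ) / G.degree u * reducedExcess G v = reducedExcess G v / G.degree u := by ring
  norm_num at h1
  rw [inv_mul_eq_div, le_div_iff₀ hpos] at h1
  linarith

/-- The degrees at the two ends of a path of length three with two inner vertices of degree two
bound each other, so they agree and the ends have the largest possible excess. -/
lemma degree_eq_of_path {u y z v : V} (hy : IsOrdinaryTwo G y) (hz : IsOrdinaryTwo G z)
    (hyz : G.Adj y z) (hyu : G.Adj y u) (huz : u ≠ z) (hzv : G.Adj z v) (hvy : v ≠ y) :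
    G.degree u = G.degree v ∧ reducedExcess G u = G.degree u / 4 := by
  have h1 := hG.degree_le_of_path hy hz hyz hyu huz hzv hvy
  have h2 := hG.degree_le_of_path hz hy hyz.symm hzv hvy hyu huz
  have h3 := hG.reducedExcess_le_quarter (hG.isOrdinary_of_adj_two hy hyu)
  have h4 := hG.reducedExcess_le_quarter (hG.isOrdinary_of_adj_two hz hzv)
  constructor
  · have : (G.degree u : ℝ) = G.degree v := by linarith
    exact_mod_cast this
  · linarith

/-- An end `u` of such a path has the largest possible excess, so that all its neighbours have
degree two. -/
lemma isOrdinaryTwo_of_path {u y z v : V} (hy : IsOrdinaryTwo G y) (hz : IsOrdinaryTwo G z)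
    (hyz : G.Adj y z) (hyu : G.Adj y u) (huz : u ≠ z) (hzv : G.Adj z v) (hvy : v ≠ y) {t : V}
    (ht : G.Adj u t) : IsOrdinaryTwo G t := by
  have hu := hG.isOrdinary_of_adj_two hy hyu
  have h1 := (hG.degree_eq_of_path hy hz hyz hyu huz hzv hvy).2
  by_contra hcon
  have := hG.reducedExcess_le_of_neighbor hu ht
    (hG.reducedWeight_le_third (hu.neighbor_degree_ne_one ht) hcon)
  linarith

/-- The two neighbours of an ordinary vertex of degree two cannot both have a large degree. -/
lemma half_lt_inv_add_inv {y u z : V} (hy : IsOrdinaryTwo G y) (hu : G.Adj y u) (hz : G.Adj y z)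
    (huz : u ≠ z) : (1 : ℝ) / 2 < 1 / G.degree u + 1 / G.degree z := by
  have h1 := hG.reducedExcess_pos hy.toIsOrdinary (by have := hy.degree_eq; omega)
  rw [hG.reducedExcess_two hy hu hz huz] at h1
  linarith

lemma degree_le_of_le {y u z : V} (hy : IsOrdinaryTwo G y) (hu : G.Adj y u) (hz : G.Adj y z)
    (huz : u ≠ z) {a b : ℕ} (ha : 0 < a) (hau : a ≤ G.degree u)
    (hab : (1 : ℝ) / a + 1 / (b + 1 : ℕ) ≤ 1 / 2) : G.degree z ≤ b := by
  by_contra hcon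
  have h1 := hG.half_lt_inv_add_inv hy hu hz huz
  have h2 : (1 : ℝ) / G.degree u ≤ 1 / a :=
    one_div_le_one_div_of_le (by exact_mod_cast ha) (by exact_mod_cast hau)
  have h3 : (1 : ℝ) / G.degree z ≤ 1 / (b + 1 : ℕ) :=
    one_div_le_one_div_of_le (by positivity) (by exact_mod_cast (by omega : b + 1 ≤ G.degree z))
  linarith

/-- If a neighbour of `t` of degree two leads on to a vertex of degree two, then all neighbours
of `t` have degree two. -/
lemma isOrdinaryTwo_of_step {t y z s : V} (hy : IsOrdinaryTwo G y) (hyt : G.Adj y t)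
    (hyz : G.Adj y z) (hzt : z ≠ t) (hz : G.degree z = 2) (hs : G.Adj t s) :
    IsOrdinaryTwo G s := by
  have hz' : IsOrdinaryTwo G z := ⟨hG.isOrdinary_of_adj_two hy hyz, hz⟩
  obtain ⟨v, hzv, hvy⟩ := exists_other_neighbor hz'.degree_ne_one hyz.symm
  exact hG.isOrdinaryTwo_of_path hy hz' hyz hyt hzt.symm hzv hvy hs

lemma isOrdinaryTwo_of_six_le {t y s : V} (ht : 6 ≤ G.degree t) (hy : IsOrdinaryTwo G y)
    (hyt : G.Adj t y) (hs : G.Adj t s) : IsOrdinaryTwo G s := by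
  obtain ⟨z, hyz, hzt⟩ := exists_other_neighbor hy.degree_ne_one hyt.symm
  have hz : G.degree z ≤ 2 := hG.degree_le_of_le hy hyt.symm hyz hzt.symm (a := 6) (b := 2)
    (by norm_num) ht (by norm_num)
  have := hG.two_le_degree (hG.isOrdinary_of_adj_two hy hyz).degree_ne_one
  exact hG.isOrdinaryTwo_of_step hy hyt.symm hyz hzt (by omega) hs

/-- If `z` has degree three and a neighbour `y` of degree two, then not all other neighbours of
`z` can have degree at least eight. -/
lemma exists_degree_lt_eight {z y : V} (hz : IsOrdinary G z) (hd : G.degree z = 3)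
    (hy : IsOrdinaryTwo G y) (h : G.Adj z y) :
    ∃ t, G.Adj z t ∧ t ≠ y ∧ G.degree t < 8 := by
  classical
  obtain ⟨a, ha, hay⟩ := exists_other_neighbor hz.degree_ne_one h
  obtain ⟨b, hby, hba, hN⟩ := exists_neighborFinset_eq_triple hd h ha hay.symm
  have hb : G.Adj z b := by rw [← G.mem_neighborFinset, hN]; simp
  by_contra! hcon
  have h0 := hG.reducedExcess_pos hz hd.le
  rw [reducedExcess, excess_of_neighborFinset_eq_triple hay.symm hby hba hN,
    hy.reducedWeight_eq, hy.degree_eq] at h0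
  have h1 := reducedWeight_le_of_le (n := 8) (by norm_num) (hcon a ha hay)
  have h2 := reducedWeight_le_of_le (n := 8) (by norm_num) (hcon b hb hby)
  norm_num at h0 h1 h2
  linarith

/-- If the neighbours `u` and `z` of `y` have the degrees `a` and `3`, then the neighbours of `z`
other than `y` have a large excess. -/
lemma reducedExcess_lower {u y z t : V} {a : ℝ} (hy : IsOrdinaryTwo G y) (hyu : G.Adj y u)
    (hyz : G.Adj y z) (huz : u ≠ z) (hz : G.degree z = 3) (hu : (G.degree u : ℝ) = a)
    (hzt : G.Adj z t) (hty : t ≠ y) :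
    IsOrdinary G t ∧ 1 / 9 ≤ (1 / a - 1 / 6) * reducedExcess G t := by
  have hoz := hG.isOrdinary_of_adj_two hy hyz
  have hot := hG.isOrdinary_of_adj hoz hz.le hzt
  refine ⟨hot, ?_⟩
  have h1 := hG.le_mul_reducedExcess hy.toIsOrdinary (by have := hy.degree_eq; omega)
    hot.degree_ne_one hty.symm hyz hzt
  rw [hG.reducedExcess_two hy hyu hyz huz, hz, hu] at h1
  norm_num at h1 ⊢
  linarith

lemma degree_ne_four_five {u y z : V} (hy : IsOrdinaryTwo G y) (hyu : G.Adj y u)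
    (hyz : G.Adj y z) (huz : u ≠ z) (hz : G.degree z = 3) :
    G.degree u ≠ 4 ∧ G.degree u ≠ 5 := by
  have hoz := hG.isOrdinary_of_adj_two hy hyz
  obtain ⟨t, hzt, hty, ht8⟩ := hG.exists_degree_lt_eight hoz hz hy hyz.symm
  have ht8' : (G.degree t : ℝ) < 8 := by exact_mod_cast ht8
  constructor
  · intro hu
    obtain ⟨hot, h1⟩ := hG.reducedExcess_lower (a := 4) hy hyu hyz huz hz (by simp [hu]) hzt hty
    have h2 := hG.reducedExcess_le_quarter hot
    have h6 : 6 ≤ G.degree t := by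
      have : (5 : ℝ) < G.degree t := by linarith
      exact_mod_cast this
    have h3 := hG.reducedExcess_le_twelfth hot fun s hs hs2 => by
      have := (hG.isOrdinaryTwo_of_six_le h6 hs2 hs hzt.symm).degree_eq
      omega
    linarith
  · intro hu
    obtain ⟨hot, h1⟩ := hG.reducedExcess_lower (a := 5) hy hyu hyz huz hz (by simp [hu]) hzt hty
    have h2 := hG.reducedExcess_le_quarter hot
    linarith

lemma degree_ne_three {u y z : V} (hy : IsOrdinaryTwo G y) (hyu : G.Adj y u)
    (hyz : G.Adj y z) (huz : u ≠ z) (hz : G.degree z = 3) : G.degree u ≠ 3 := by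
  intro hu
  have hoz := hG.isOrdinary_of_adj_two hy hyz
  obtain ⟨t, hzt, hty, ht8⟩ := hG.exists_degree_lt_eight hoz hz hy hyz.symm
  obtain ⟨hot, h1⟩ := hG.reducedExcess_lower (a := 3) hy hyu hyz huz hz (by simp [hu]) hzt hty
  have hκ : reducedWeight G z ≤ 1 / 3 := by rw [hoz.reducedWeight_eq, hz]; norm_num
  have h2 := hG.reducedExcess_le_of_neighbor hot hzt.symm hκ
  have ht4 : 4 ≤ G.degree t := by
    have : (3 : ℝ) < G.degree t := by linarith
    exact_mod_cast this
  have h3 := hG.reducedExcess_le_twelfth hot fun s hs hs2 => by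
    obtain ⟨r, hsr, hrt⟩ := exists_other_neighbor hs2.degree_ne_one hs.symm
    have hr2 := hG.two_le_degree (hG.isOrdinary_of_adj_two hs2 hsr).degree_ne_one
    have hr3 : G.degree r ≤ 3 := hG.degree_le_of_le hs2 hs.symm hsr hrt.symm (a := 4) (b := 3)
      (by norm_num) ht4 (by norm_num)
    by_cases hr : G.degree r = 3
    · have h45 := hG.degree_ne_four_five hs2 hs.symm hsr hrt.symm hr
      have h5 : G.degree t ≤ 5 := hG.degree_le_of_le hs2 hsr hs.symm hrt (a := 3) (b := 5)
        (by norm_num) hr.ge (by norm_num)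
      omega
    · have := (hG.isOrdinaryTwo_of_step hs2 hs.symm hsr hrt (by omega) hzt.symm).degree_eq
      omega
  have ht8' : (G.degree t : ℝ) < 8 := by exact_mod_cast ht8
  linarith

/-- By `half_lt_inv_add_inv` the two neighbours of `y` could otherwise only have the degrees
`(3, 3)`, `(3, 4)` or `(3, 5)`, in some order. -/
lemma degree_eq_two_of_three_le {u y z : V} (hu : 3 ≤ G.degree u) (hy : IsOrdinaryTwo G y)
    (hyu : G.Adj y u) (hyz : G.Adj y z) (huz : u ≠ z) : G.degree z = 2 := by
  have hz2 := hG.two_le_degree (hG.isOrdinary_of_adj_two hy hyz).degree_ne_one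
  by_contra hcon
  have hz5 : G.degree z ≤ 5 := hG.degree_le_of_le hy hyu hyz huz (a := 3) (b := 5)
    (by norm_num) hu (by norm_num)
  have hu5 : G.degree u ≤ 5 := hG.degree_le_of_le hy hyz hyu huz.symm (a := 3) (b := 5)
    (by norm_num) (by omega) (by norm_num)
  by_cases hz3 : G.degree z = 3
  · have h1 := hG.degree_ne_four_five hy hyu hyz huz hz3
    have h2 := hG.degree_ne_three hy hyu hyz huz hz3
    omega
  · have hu3 : G.degree u ≤ 3 := hG.degree_le_of_le hy hyz hyu huz.symm (a := 4) (b := 3)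
      (by norm_num) (by omega) (by norm_num)
    have h1 := hG.degree_ne_four_five hy hyz hyu huz.symm (by omega)
    omega

lemma exists_isOrdinary (hP : ∀ u v, HasPendant G u → HasPendant G v → ¬ G.Adj u v) :
    ∃ v, IsOrdinary G v := by
  have key : ∀ w, HasPendant G w → ∃ v, IsOrdinary G v := by
    rintro w ⟨l, hwl, hl⟩
    obtain ⟨v, hv, hvl⟩ := exists_other_neighbor (hG.degree_ne_one_of_adj_leaf hl hwl) hwl
    exact ⟨v, fun h => hvl (hG.leaf_unique h hl hv hwl), fun h => hP w v ⟨l, hwl, hl⟩ h hv⟩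
  obtain ⟨v⟩ := hG.connected.nonempty
  by_cases h1 : G.degree v = 1
  · obtain ⟨w, hw⟩ := (G.degree_pos_iff_exists_adj v).1 (hG.degree_pos v)
    exact key w ⟨v, hw.symm, h1⟩
  · by_cases h2 : HasPendant G v
    · exact key v h2
    · exact ⟨v, h1, h2⟩

/-- If all ordinary vertices had degree at least three, then those of degree three would have
too small an excess, and without them no excess would be positive. -/
lemma exists_isOrdinaryTwo (hP : ∀ u v, HasPendant G u → HasPendant G v → ¬ G.Adj u v) :
    ∃ v, IsOrdinaryTwo G v := by
  classical
  by_contra! hno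
  have h3 : ∀ v, IsOrdinary G v → 3 ≤ G.degree v := fun v hv => by
    have := hG.two_le_degree hv.degree_ne_one
    by_contra hcon
    exact hno v ⟨hv, by omega⟩
  have h12 : ∀ v, IsOrdinary G v → reducedExcess G v ≤ G.degree v / 12 := fun v hv =>
    hG.reducedExcess_le_twelfth hv fun y _ => hno y
  have h4 : ∀ v, IsOrdinary G v → 4 ≤ G.degree v := by
    intro w hw
    by_contra hcon
    have hw3 : G.degree w = 3 := by have := h3 w hw; omega
    have hpos := hG.reducedExcess_pos hw hw3.le
    by_cases hu : ∃ u, G.Adj w u ∧ G.degree u = 3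
    · obtain ⟨u, hwu, hu3⟩ := hu
      have hou := hG.isOrdinary_of_adj hw hw3.le hwu
      have hu12 := h12 u hou
      have h6 : ∀ v, G.Adj w v → v ≠ u → 6 ≤ G.degree v := by
        intro v hwv hvu
        have hov := hG.isOrdinary_of_adj hw hw3.le hwv
        have h := hG.le_mul_reducedExcess hou hu3.le hov.degree_ne_one hvu.symm hwu.symm hwv
        have h0 := hG.reducedExcess_nonneg hov.degree_ne_one
        rw [hu3] at hu12
        rw [hw3] at h
        push_cast at h hu12
        have : (5 : ℝ) < G.degree v := by nlinarith [h12 v hov]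
        exact_mod_cast this
      obtain ⟨a, ha, hau⟩ := exists_other_neighbor hw.degree_ne_one hwu
      obtain ⟨b, hbu, hba, hN⟩ := exists_neighborFinset_eq_triple hw3 hwu ha hau.symm
      have hb : G.Adj w b := by rw [← G.mem_neighborFinset, hN]; simp
      rw [reducedExcess, excess_of_neighborFinset_eq_triple hau.symm hbu hba hN,
        hou.reducedWeight_eq, hu3] at hpos
      have h1 := reducedWeight_le_of_le (n := 6) (by norm_num) (h6 a ha hau)
      have h2 := reducedWeight_le_of_le (n := 6) (by norm_num) (h6 b hb hbu)
      norm_num at hpos h1 h2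
      linarith
    · push Not at hu
      have := excess_le (κ := reducedWeight G) (u := w) (b := 1 / 4) fun y hy => by
        have := h3 y (hG.isOrdinary_of_adj hw hw3.le hy)
        have h := hu y hy
        simpa using reducedWeight_le_of_le (n := 4) (by norm_num) (v := y) (by omega)
      unfold reducedExcess at hpos
      linarith
  obtain ⟨t, ht⟩ := hG.exists_isOrdinary hP
  have hκ : ∀ y, G.Adj t y → reducedWeight G y ≤ 1 / 4 := fun y hy => by
    by_cases hp : HasPendant G y
    · linarith [hp.reducedWeight_le]
    · simpa using reducedWeight_le_of_le (n := 4) (by norm_num)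
        (h4 y ⟨ht.neighbor_degree_ne_one hy, hp⟩)
  have h0 := hG.reducedExcess_nonneg ht.degree_ne_one
  have hord : ∀ y, G.Adj t y → IsOrdinary G y := fun y hy => by
    refine ⟨ht.neighbor_degree_ne_one hy, fun hp => ?_⟩
    have := excess_le_of_neighbor hκ hy hp.reducedWeight_le
    unfold reducedExcess at h0
    linarith
  have hle : reducedExcess G t ≤ 0 := by
    have := excess_le hκ
    unfold reducedExcess
    linarith
  obtain ⟨w, hw⟩ := (G.degree_pos_iff_exists_adj t).1 (hG.degree_pos t)
  have how := hord w hw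
  obtain ⟨v, hv, hvt⟩ := exists_other_neighbor how.degree_ne_one hw.symm
  have hM := le_commonWeight (κ := reducedWeight G) (fun y hy _ => by
    rw [(hord y hy).reducedWeight_eq]; positivity) hw hv.symm
  have hsq := hG.sq_reducedCommon_le ht.degree_ne_one (how.neighbor_degree_ne_one hv) hvt.symm
  rw [how.reducedWeight_eq] at hM
  rw [le_antisymm hle h0, zero_mul] at hsq
  have hpos : (0 : ℝ) < 1 / G.degree w := by
    have := hG.degree_pos w; positivity
  nlinarith [pow_pos (hpos.trans_le hM) 2]

end HasWideGap

variable (G) in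
/-- A vertex `x` all of whose neighbours have degree two and lead on to vertices of degree two. -/
structure IsHub (x : V) : Prop where
  isOrdinary : IsOrdinary G x
  neighbor : ∀ y, G.Adj x y → IsOrdinaryTwo G y
  next : ∀ y z, G.Adj x y → G.Adj y z → z ≠ x → IsOrdinaryTwo G z

/-- A vertex of degree at least three with a neighbour of degree two is a hub. If there is none,
then by connectedness all vertices have degree two, so that all are hubs. -/
lemma HasWideGap.exists_isHub (hG : HasWideGap G)
    (hP : ∀ u v, HasPendant G u → HasPendant G v → ¬ G.Adj u v) : ∃ x, IsHub G x := by
  by_cases h : ∃ u, 3 ≤ G.degree u ∧ ∃ y, G.Adj u y ∧ IsOrdinaryTwo G y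
  · obtain ⟨u, hu3, y, huy, hy⟩ := h
    have hstep : ∀ y z, G.Adj u y → IsOrdinaryTwo G y → G.Adj y z → z ≠ u → G.degree z = 2 :=
      fun y z huy hy hyz hzu => hG.degree_eq_two_of_three_le hu3 hy huy.symm hyz hzu.symm
    obtain ⟨z, hyz, hzu⟩ := exists_other_neighbor hy.degree_ne_one huy.symm
    have hall : ∀ s, G.Adj u s → IsOrdinaryTwo G s := fun s hs =>
      hG.isOrdinaryTwo_of_step hy huy.symm hyz hzu (hstep y z huy hy hyz hzu) hs
    exact ⟨u, hG.isOrdinary_of_adj_two hy huy.symm, hall, fun y z huy hyz hzu =>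
      ⟨hG.isOrdinary_of_adj_two (hall y huy) hyz, hstep y z huy (hall y huy) hyz hzu⟩⟩
  · push Not at h
    obtain ⟨x, hx⟩ := hG.exists_isOrdinaryTwo hP
    have hall : ∀ v, v ∈ {v | IsOrdinaryTwo G v} := by
      refine hG.connected.mem_of_closed (x := x) hx fun u hu v huv => ?_
      have hv := hG.isOrdinary_of_adj_two hu huv
      have h2 := hG.two_le_degree hv.degree_ne_one
      refine ⟨hv, ?_⟩
      by_contra hcon
      exact h v (by omega) u huv.symm hu
    exact ⟨x, (hall x).toIsOrdinary, fun y _ => hall y, fun _ z _ _ _ => hall z⟩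

end Reduced

/-! ### Recognizing petal graphs and book graphs -/

section Models

lemma petalGraph_adj_center (m : ℕ) (u : Unit) (t : Unit ⊕ (Fin m ⊕ Fin m)) :
    (petalGraph m).Adj (Sum.inl u) t ↔
      ∃ i, t = Sum.inr (Sum.inl i) ∨ t = Sum.inr (Sum.inr i) := by
  rcases t with _ | t | t <;> simp [petalGraph]

lemma petalGraph_adj_left {m : ℕ} (i : Fin m) (t : Unit ⊕ (Fin m ⊕ Fin m)) :
    (petalGraph m).Adj (Sum.inr (Sum.inl i)) t ↔ t = Sum.inl () ∨ t = Sum.inr (Sum.inr i) := by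
  rcases t with _ | t | t <;> simp [petalGraph, eq_comm]

lemma petalGraph_adj_right {m : ℕ} (i : Fin m) (t : Unit ⊕ (Fin m ⊕ Fin m)) :
    (petalGraph m).Adj (Sum.inr (Sum.inr i)) t ↔ t = Sum.inl () ∨ t = Sum.inr (Sum.inl i) := by
  rcases t with _ | t | t <;> simp [petalGraph, eq_comm]

lemma bookGraph_adj_left_hub (m : ℕ) (t : Fin 2 ⊕ (Fin m ⊕ Fin m)) :
    (bookGraph m).Adj (Sum.inl 0) t ↔ ∃ i, t = Sum.inr (Sum.inl i) := by
  rcases t with t | t | t <;> simp [bookGraph]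

lemma bookGraph_adj_right_hub (m : ℕ) (t : Fin 2 ⊕ (Fin m ⊕ Fin m)) :
    (bookGraph m).Adj (Sum.inl 1) t ↔ ∃ i, t = Sum.inr (Sum.inr i) := by
  rcases t with t | t | t <;> simp [bookGraph]

lemma bookGraph_adj_left {m : ℕ} (i : Fin m) (t : Fin 2 ⊕ (Fin m ⊕ Fin m)) :
    (bookGraph m).Adj (Sum.inr (Sum.inl i)) t ↔ t = Sum.inl 0 ∨ t = Sum.inr (Sum.inr i) := by
  rcases t with t | t | t <;> simp [bookGraph, eq_comm]

lemma bookGraph_adj_right {m : ℕ} (i : Fin m) (t : Fin 2 ⊕ (Fin m ⊕ Fin m)) :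
    (bookGraph m).Adj (Sum.inr (Sum.inr i)) t ↔ t = Sum.inl 1 ∨ t = Sum.inr (Sum.inl i) := by
  rcases t with t | t | t <;> simp [bookGraph, eq_comm]

/-- An injection into a connected graph that maps neighbourhoods onto neighbourhoods is an
isomorphism. -/
lemma SimpleGraph.Connected.nonempty_iso {V W : Type*} [Nonempty W] {G : SimpleGraph V}
    {H : SimpleGraph W} (hG : G.Connected) {F : W → V} (hF : Function.Injective F)
    (h : ∀ p t, G.Adj (F p) t ↔ ∃ s, H.Adj p s ∧ F s = t) : Nonempty (G ≃g H) := by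
  have hsurj : Function.Surjective F := by
    refine hG.mem_of_closed (S := Set.range F) ⟨Classical.arbitrary W, rfl⟩ ?_
    rintro _ ⟨p, rfl⟩ v hv
    obtain ⟨s, -, rfl⟩ := (h p v).1 hv
    exact ⟨s, rfl⟩
  have e : H ≃g G := ⟨Equiv.ofBijective F ⟨hF, hsurj⟩, fun {a b} => by
    change G.Adj (F a) (F b) ↔ H.Adj a b
    rw [h]
    simp only [hF.eq_iff, exists_eq_right]⟩
  exact ⟨e.symm⟩

variable {V : Type*} {G : SimpleGraph V}

lemma isPetalGraph_of_labelling (hG : G.Connected) {m : ℕ} (hm : 1 ≤ m) {x : V} {a b : Fin m → V}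
    (hF : Function.Injective (Sum.elim (fun _ : Unit => x) (Sum.elim a b)))
    (hx : ∀ t, G.Adj x t ↔ ∃ i, t = a i ∨ t = b i)
    (ha : ∀ i t, G.Adj (a i) t ↔ t = x ∨ t = b i)
    (hb : ∀ i t, G.Adj (b i) t ↔ t = x ∨ t = a i) : IsPetalGraph G := by
  refine ⟨m, hm, hG.nonempty_iso hF ?_⟩
  rintro (_ | i | i) t
  · simp only [petalGraph_adj_center, Sum.elim_inl, hx]
    constructor
    · rintro ⟨i, rfl | rfl⟩
      exacts [⟨_, ⟨i, Or.inl rfl⟩, rfl⟩, ⟨_, ⟨i, Or.inr rfl⟩, rfl⟩]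
    · rintro ⟨_, ⟨i, rfl | rfl⟩, rfl⟩
      exacts [⟨i, Or.inl rfl⟩, ⟨i, Or.inr rfl⟩]
  · simp [petalGraph_adj_left, ha, eq_comm]
  · simp [petalGraph_adj_right, hb, eq_comm]

lemma isBookGraph_of_labelling (hG : G.Connected) {m : ℕ} (hm : 1 ≤ m) {x y : V} {a b : Fin m → V}
    (hF : Function.Injective (Sum.elim ![x, y] (Sum.elim a b)))
    (hx : ∀ t, G.Adj x t ↔ ∃ i, t = a i) (hy : ∀ t, G.Adj y t ↔ ∃ i, t = b i)
    (ha : ∀ i t, G.Adj (a i) t ↔ t = x ∨ t = b i)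
    (hb : ∀ i t, G.Adj (b i) t ↔ t = y ∨ t = a i) : IsBookGraph G := by
  refine ⟨m, hm, hG.nonempty_iso hF ?_⟩
  rintro (j | i | i) t
  · fin_cases j
    · simp [bookGraph_adj_left_hub, hx, eq_comm]
    · simp [bookGraph_adj_right_hub, hy, eq_comm]
  · simp [bookGraph_adj_left, ha, eq_comm]
  · simp [bookGraph_adj_right, hb, eq_comm]

end Models

section Structure

variable {V : Type*} [Fintype V] {G : SimpleGraph V} [DecidableRel G.Adj]

/-- Two adjacent support vertices of leaves span a path on four vertices, the `1`-book graph. -/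
lemma HasWideGap.isBookGraph_of_adj_pendant (hG : HasWideGap G) {w t : V} (hw : HasPendant G w)
    (ht : HasPendant G t) (h : G.Adj w t) : IsBookGraph G := by
  obtain ⟨hdw, hdt⟩ := hG.degree_eq_two_of_adj_pendant hw ht h
  obtain ⟨l, hwl, hl⟩ := hw
  obtain ⟨l', htl', hl'⟩ := ht
  have hlt : l ≠ t := by rintro rfl; omega
  have hlw : l' ≠ w := by rintro rfl; omega
  have hll : l ≠ l' := by
    rintro rfl
    exact h.ne (eq_of_adj_leaf hl htl'.symm hwl.symm)
  refine isBookGraph_of_labelling hG.connected le_rfl (x := l) (y := l') (a := fun _ => w)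
    (b := fun _ => t) ?_ ?_ ?_ ?_ ?_
  · rw [Sum.elim_injective, Sum.elim_injective]
    refine ⟨?_, ⟨Function.injective_of_subsingleton _, Function.injective_of_subsingleton _,
      fun _ _ => h.ne⟩, ?_⟩
    · intro i j hij
      fin_cases i <;> fin_cases j <;> simp_all
    · rintro i (j | j) <;> fin_cases i
      exacts [hwl.ne', hlw, hlt, htl'.ne']
  · intro s
    exact ⟨fun hs => ⟨0, eq_of_adj_leaf hl hwl.symm hs⟩, by rintro ⟨_, rfl⟩; exact hwl.symm⟩
  · intro s
    exact ⟨fun hs => ⟨0, eq_of_adj_leaf hl' htl'.symm hs⟩, by rintro ⟨_, rfl⟩; exact htl'.symm⟩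
  · exact fun _ s => adj_iff_of_degree_two hdw hwl h hlt s
  · exact fun _ s => adj_iff_of_degree_two hdt htl' h.symm hlw s

lemma commonWeight_of_pair [DecidableEq V] (κ : V → ℝ) {u a b : V} (hab : a ≠ b)
    (hu : ∀ t, G.Adj u t ↔ t = a ∨ t = b) (v : V) :
    commonWeight G κ u v = (if G.Adj v a then κ a else 0) + (if G.Adj v b then κ b else 0) := by
  have : G.neighborFinset u = {a, b} := by ext t; simp [hu]
  rw [commonWeight, this, ← Finset.filter_mem_eq_inter, Finset.sum_filter, Finset.sum_pair hab]
  simp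

/-- For two neighbours `u₁`, `u₂` of a hub, the function `δ_{u₁} - δ_{u₂}` lies in the kernel of
the reduced form. -/
lemma HasWideGap.commonWeight_eq_of_isHub [DecidableEq V] (hG : HasWideGap G) {x : V}
    (hx : IsHub G x) {u₁ u₂ : V} (h₁ : G.Adj x u₁) (h₂ : G.Adj x u₂) (hne : u₁ ≠ u₂) :
    commonWeight G (reducedWeight G) u₁ u₂ = 1 / G.degree x ∧
      ∀ t, G.degree t ≠ 1 → t ≠ u₁ → t ≠ u₂ →
        commonWeight G (reducedWeight G) u₁ t = commonWeight G (reducedWeight G) u₂ t := by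
  have hex : ∀ u, G.Adj x u → reducedExcess G u = 1 / G.degree x := by
    intro u hu
    have hu2 := hx.neighbor u hu
    obtain ⟨z, huz, hzx⟩ := exists_other_neighbor hu2.degree_ne_one hu.symm
    rw [hG.reducedExcess_two hu2 hu.symm huz hzx.symm, (hx.next u z hu huz hzx).degree_eq]
    norm_num
  have hd₁ := (hx.neighbor u₁ h₁).degree_ne_one
  have hd₂ := (hx.neighbor u₂ h₂).degree_ne_one
  have hM : commonWeight G (reducedWeight G) u₁ u₂ = 1 / G.degree x := by
    have hle := le_commonWeight (κ := reducedWeight G) (fun y hy _ => by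
      rw [(hG.isOrdinary_of_adj_two (hx.neighbor u₁ h₁) hy).reducedWeight_eq]; positivity)
      h₁.symm h₂.symm
    rw [hx.isOrdinary.reducedWeight_eq] at hle
    have hsq := hG.sq_reducedCommon_le hd₁ hd₂ hne
    rw [hex u₁ h₁, hex u₂ h₂, ← sq] at hsq
    exact le_antisymm (abs_le_of_sq_le_sq' hsq (by positivity)).2 hle
  refine ⟨hM, fun t ht ht₁ ht₂ => ?_⟩
  have hmem := (vanishingAtLeaves G).sub_mem (single_mem_vanishingAtLeaves hd₁)
    (single_mem_vanishingAtLeaves hd₂)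
  have hcs := twoStepForm_sq_le hG.reduced_nonneg hmem (single_mem_vanishingAtLeaves ht)
  have hker : twoStepForm G (reducedWeight G) (Pi.single u₁ 1 - Pi.single u₂ 1)
      (Pi.single u₁ 1 - Pi.single u₂ 1) = 0 := by
    rw [twoStepForm_sub_left, twoStepForm_comm, twoStepForm_sub_left,
      twoStepForm_comm _ (Pi.single u₂ 1) (_ - _), twoStepForm_sub_left, twoStepForm_single_self,
      twoStepForm_single_self, twoStepForm_comm _ (Pi.single u₂ 1),
      twoStepForm_single_of_ne _ hne, hM]
    change reducedExcess G u₁ - _ - (_ - reducedExcess G u₂) = 0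
    rw [hex u₁ h₁, hex u₂ h₂]
    ring
  rw [hker, zero_mul, twoStepForm_sub_left, twoStepForm_single_of_ne _ ht₁.symm,
    twoStepForm_single_of_ne _ ht₂.symm] at hcs
  have := pow_eq_zero_iff two_ne_zero |>.1 (le_antisymm hcs (sq_nonneg _))
  linarith

/-- All paths of length three that start at a hub `x` (and do not turn back) end at the same
vertex `z`, which is `x` itself in the petal graph. -/
lemma HasWideGap.exists_of_isHub (hG : HasWideGap G) {x : V} (hx : IsHub G x) :
    ∃ (z : V) (φ : V → V), G.degree z = G.degree x ∧ ∀ y, G.Adj x y →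
      (∀ t, G.Adj y t ↔ t = x ∨ t = φ y) ∧ (∀ t, G.Adj (φ y) t ↔ t = z ∨ t = y) ∧
      φ y ≠ x ∧ y ≠ z := by
  classical
  have hφ : ∀ y, ∃ z, G.Adj x y → G.Adj y z ∧ z ≠ x := fun y => by
    by_cases hy : G.Adj x y
    · obtain ⟨z, hz⟩ := exists_other_neighbor (hx.neighbor y hy).degree_ne_one hy.symm
      exact ⟨z, fun _ => hz⟩
    · exact ⟨x, fun h => absurd h hy⟩
  choose φ hφ using hφ
  have hφ2 : ∀ y, G.Adj x y → IsOrdinaryTwo G (φ y) := fun y hy =>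
    hx.next y _ hy (hφ y hy).1 (hφ y hy).2
  have hψ : ∀ y, ∃ v, G.Adj x y → G.Adj (φ y) v ∧ v ≠ y := fun y => by
    by_cases hy : G.Adj x y
    · obtain ⟨z, hz⟩ := exists_other_neighbor (hφ2 y hy).degree_ne_one (hφ y hy).1.symm
      exact ⟨z, fun _ => hz⟩
    · exact ⟨x, fun h => absurd h hy⟩
  choose ψ hψ using hψ
  have hN : ∀ y, G.Adj x y → ∀ t, G.Adj y t ↔ t = x ∨ t = φ y := fun y hy =>
    adj_iff_of_degree_two (hx.neighbor y hy).degree_eq hy.symm (hφ y hy).1 (hφ y hy).2.symm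
  have hN' : ∀ y, G.Adj x y → ∀ t, G.Adj (φ y) t ↔ t = ψ y ∨ t = y := fun y hy =>
    adj_iff_of_degree_two (hφ2 y hy).degree_eq (hψ y hy).1 (hφ y hy).1.symm (hψ y hy).2
  have hdeg : ∀ y, G.Adj x y → G.degree (ψ y) = G.degree x := fun y hy =>
    (hG.degree_eq_of_path (hx.neighbor y hy) (hφ2 y hy) (hφ y hy).1 hy.symm (hφ y hy).2.symm
      (hψ y hy).1 (hψ y hy).2).1.symm
  have hM : ∀ y, G.Adj x y → ∀ v, commonWeight G (reducedWeight G) y v =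
      (if G.Adj v x then 1 / (G.degree x : ℝ) else 0) + (if G.Adj v (φ y) then 1 / 2 else 0) := by
    intro y hy v
    rw [commonWeight_of_pair _ (hφ y hy).2.symm (hN y hy), hx.isOrdinary.reducedWeight_eq,
      (hφ2 y hy).reducedWeight_eq, (hφ2 y hy).degree_eq]
    norm_num
  have hnadj : ∀ y₁ y₂, G.Adj x y₁ → G.Adj x y₂ → y₁ ≠ y₂ → ¬ G.Adj y₂ (φ y₁) := by
    intro y₁ y₂ h₁ h₂ hne hadj
    have := (hG.commonWeight_eq_of_isHub hx h₁ h₂ hne).1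
    rw [hM y₁ h₁, if_pos h₂.symm, if_pos hadj] at this
    linarith
  have hψne : ∀ y₁ y₂, G.Adj x y₁ → G.Adj x y₂ → y₂ ≠ ψ y₁ := by
    rintro y₁ _ h₁ h₂ rfl
    exact hnadj y₁ _ h₁ h₂ (hψ y₁ h₁).2.symm (hψ y₁ h₁).1.symm
  have hψeq : ∀ y₁ y₂, G.Adj x y₁ → G.Adj x y₂ → ψ y₁ = ψ y₂ := by
    intro y₁ y₂ h₁ h₂
    by_cases hne : y₁ = y₂
    · rw [hne]
    have h := (hG.commonWeight_eq_of_isHub hx h₁ h₂ hne).2 (ψ y₁)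
      (by rw [hdeg y₁ h₁]; exact hx.isOrdinary.degree_ne_one) (hψ y₁ h₁).2
      (hψne y₁ y₂ h₁ h₂).symm
    rw [hM y₁ h₁, hM y₂ h₂, if_pos (hψ y₁ h₁).1.symm] at h
    have hadj : G.Adj (ψ y₁) (φ y₂) := by
      by_contra hcon
      rw [if_neg hcon] at h
      linarith
    exact ((hN' y₂ h₂ _).1 hadj.symm).resolve_right (hψne y₁ y₂ h₁ h₂).symm
  obtain ⟨y₀, hy₀⟩ := (G.degree_pos_iff_exists_adj x).1 (hG.degree_pos x)
  refine ⟨ψ y₀, φ, hdeg y₀ hy₀, fun y hy => ⟨hN y hy, ?_, (hφ y hy).2, hψne y₀ y hy₀ hy⟩⟩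
  rw [hψeq y₀ y hy₀ hy]
  exact hN' y hy

/-- The classification: around a hub `x` the graph is a petal graph if the paths of
`HasWideGap.exists_of_isHub` return to `x`, and a book graph otherwise. -/
lemma HasWideGap.isPetalGraph_or_isBookGraph (hG : HasWideGap G) :
    IsPetalGraph G ∨ IsBookGraph G := by
  classical
  by_cases hP : ∀ u v, HasPendant G u → HasPendant G v → ¬ G.Adj u v
  swap
  · push Not at hP
    obtain ⟨u, v, hu, hv, h⟩ := hP
    exact Or.inr (hG.isBookGraph_of_adj_pendant hu hv h)
  obtain ⟨x, hx⟩ := hG.exists_isHub hP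
  obtain ⟨z, φ, hdeg, h⟩ := hG.exists_of_isHub hx
  have hφinj : ∀ y₁ y₂, G.Adj x y₁ → G.Adj x y₂ → φ y₁ = φ y₂ → y₁ = y₂ := by
    intro y₁ y₂ h₁ h₂ he
    have : G.Adj (φ y₁) y₂ := by rw [he]; exact ((h y₂ h₂).2.1 y₂).2 (Or.inr rfl)
    exact ((((h y₁ h₁).2.1 y₂).1 this).resolve_left (h y₂ h₂).2.2.2).symm
  have hadj : ∀ y, G.Adj x y → G.Adj y (φ y) := fun y hy => ((h y hy).1 _).2 (Or.inr rfl)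
  by_cases hzx : z = x
  · left
    subst hzx
    have hφx : ∀ y, G.Adj z y → G.Adj z (φ y) := fun y hy =>
      (((h y hy).2.1 z).2 (Or.inl rfl)).symm
    have hφφ : ∀ y, G.Adj z y → φ (φ y) = y := fun y hy =>
      ((((h y hy).2.1 _).1 (hadj _ (hφx y hy))).resolve_left (h _ (hφx y hy)).2.2.1)
    -- an auxiliary order on the vertices selects one vertex of each petal
    set r := Fintype.equivFin V
    set A : Finset V := (G.neighborFinset z).filter fun y => r y < r (φ y) with hA
    have hmemA : ∀ y, y ∈ A ↔ G.Adj z y ∧ r y < r (φ y) := fun y => by simp [hA]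
    have hor : ∀ y, G.Adj z y → y ∈ A ∨ φ y ∈ A := by
      intro y hy
      rw [hmemA, hmemA, hφφ y hy]
      rcases lt_trichotomy (r y) (r (φ y)) with hlt | heq | hlt
      · exact Or.inl ⟨hy, hlt⟩
      · exact absurd (r.injective heq) (hadj y hy).ne
      · exact Or.inr ⟨hφx y hy, hlt⟩
    set e : Fin A.card ≃ A := A.equivFin.symm
    have he : ∀ i, G.Adj z (e i : V) ∧ r (e i : V) < r (φ (e i)) := fun i => (hmemA _).1 (e i).2
    have hsurj : ∀ y ∈ A, ∃ i, y = e i := fun y hy => ⟨e.symm ⟨y, hy⟩, by simp⟩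
    refine isPetalGraph_of_labelling hG.connected (m := A.card) ?_ (x := z)
      (a := fun i => (e i : V)) (b := fun i => φ (e i)) ?_ ?_ ?_ ?_
    · obtain ⟨y, hy⟩ := (G.degree_pos_iff_exists_adj z).1 (hG.degree_pos z)
      rcases hor y hy with hy | hy <;> exact Finset.card_pos.2 ⟨_, hy⟩
    · rw [Sum.elim_injective, Sum.elim_injective]
      refine ⟨Function.injective_of_subsingleton _, ⟨fun i j hij => e.injective (Subtype.ext hij),
        fun i j hij => e.injective (Subtype.ext (hφinj _ _ (he i).1 (he j).1 hij)), ?_⟩, ?_⟩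
      · intro i j hij
        have hi := (he i).2
        rw [hij, hφφ _ (he j).1] at hi
        exact lt_asymm hi (he j).2
      · rintro _ (i | i)
        exacts [(he i).1.ne, (hφx _ (he i).1).ne]
    · intro t
      constructor
      · intro ht
        rcases hor t ht with ht' | ht'
        · obtain ⟨i, hi⟩ := hsurj t ht'
          exact ⟨i, Or.inl hi⟩
        · obtain ⟨i, hi⟩ := hsurj _ ht'
          exact ⟨i, Or.inr (by rw [← hi, hφφ t ht])⟩
      · rintro ⟨i, rfl | rfl⟩
        exacts [(he i).1, hφx _ (he i).1]
    · exact fun i => (h _ (he i).1).1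
    · exact fun i => (h _ (he i).1).2.1
  · right
    have hφN : ∀ y, G.Adj x y → ¬ G.Adj x (φ y) := by
      intro y hy hcon
      rcases ((h y hy).2.1 x).1 hcon.symm with hc | hc
      exacts [hzx hc.symm, hy.ne hc]
    have himage : (G.neighborFinset x).image φ = G.neighborFinset z := by
      apply Finset.eq_of_subset_of_card_le
      · intro t ht
        obtain ⟨y, hy, rfl⟩ := Finset.mem_image.1 ht
        rw [SimpleGraph.mem_neighborFinset] at hy ⊢
        exact (((h y hy).2.1 z).2 (Or.inl rfl)).symm
      · rw [Finset.card_image_of_injOn, G.card_neighborFinset_eq_degree,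
          G.card_neighborFinset_eq_degree, hdeg]
        intro y₁ h₁ y₂ h₂
        exact hφinj y₁ y₂ (by simpa using h₁) (by simpa using h₂)
    set e : Fin (G.neighborFinset x).card ≃ G.neighborFinset x := (G.neighborFinset x).equivFin.symm
    have he : ∀ i, G.Adj x (e i : V) := fun i => (G.mem_neighborFinset _ _).1 (e i).2
    have hsurj : ∀ y, G.Adj x y → ∃ i, y = e i := fun y hy =>
      ⟨e.symm ⟨y, by simpa using hy⟩, by rw [Equiv.apply_symm_apply]⟩
    have hzφ : ∀ t, G.Adj z t ↔ ∃ y, G.Adj x y ∧ φ y = t := fun t => by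
      rw [← G.mem_neighborFinset, ← himage]; simp
    refine isBookGraph_of_labelling hG.connected (m := (G.neighborFinset x).card) ?_ (x := x)
      (y := z) (a := fun i => (e i : V)) (b := fun i => φ (e i)) ?_ ?_ ?_ ?_ ?_
    · rw [G.card_neighborFinset_eq_degree]; exact hG.degree_pos x
    · rw [Sum.elim_injective, Sum.elim_injective]
      refine ⟨?_, ⟨fun i j hij => e.injective (Subtype.ext hij),
        fun i j hij => e.injective (Subtype.ext (hφinj _ _ (he i) (he j) hij)), ?_⟩, ?_⟩
      · intro i j hij
        fin_cases i <;> fin_cases j <;> simp_all [eq_comm]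
      · intro i j hij
        exact hφN _ (he j) (hij ▸ he i)
      · rintro j (i | i) <;> fin_cases j
        · exact (he i).ne
        · exact (h _ (he i)).2.2.2.symm
        · exact (h _ (he i)).2.2.1.symm
        · exact (((h _ (he i)).2.1 z).2 (Or.inl rfl)).ne'
    · exact fun t => ⟨hsurj t, by rintro ⟨i, rfl⟩; exact he i⟩
    · intro t
      rw [hzφ]
      constructor
      · rintro ⟨y, hy, rfl⟩
        obtain ⟨i, rfl⟩ := hsurj y hy
        exact ⟨i, rfl⟩
      · rintro ⟨i, rfl⟩
        exact ⟨_, he i, rfl⟩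
    · exact fun i => (h _ (he i)).1
    · exact fun i => (h _ (he i)).2.1

end Structure

/-! ### Spectra -/

section Spectrum

variable {V : Type*} [Fintype V] {G : SimpleGraph V} [DecidableRel G.Adj]

lemma mem_laplacianSpectrum_iff {l : ℝ} : l ∈ laplacianSpectrum G ↔ ∃ f : V → ℝ, f ≠ 0 ∧
    ∀ v, 1 / (G.degree v : ℝ) * ∑ w ∈ G.neighborFinset v, f w = (1 - l) * f v := by
  have key : ∀ f : V → ℝ, normalizedLaplacian G f = l • f ↔
      ∀ v, 1 / (G.degree v : ℝ) * ∑ w ∈ G.neighborFinset v, f w = (1 - l) * f v := by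
    intro f
    rw [funext_iff]
    refine forall_congr' fun v => ?_
    change f v - 1 / (G.degree v : ℝ) * ∑ w ∈ G.neighborFinset v, f w = l * f v ↔ _
    constructor <;> intro h <;> linarith
  constructor
  · intro h
    obtain ⟨f, hf⟩ := Module.End.HasEigenvalue.exists_hasEigenvector h
    exact ⟨f, hf.2, (key f).1 hf.apply_eq_smul⟩
  · rintro ⟨f, hf, h⟩
    exact Module.End.hasEigenvalue_of_hasEigenvector
      (Module.End.hasEigenvector_iff.2 ⟨Module.End.mem_eigenspace_iff.2 ((key f).2 h), hf⟩)

lemma sum_neighborFinset_iso {W : Type*} [Fintype W] {H : SimpleGraph W} [DecidableRel H.Adj]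
    (e : G ≃g H) (f : W → ℝ) (v : V) :
    ∑ w ∈ G.neighborFinset v, f (e w) = ∑ w ∈ H.neighborFinset (e v), f w :=
  Finset.sum_equiv e.toEquiv (fun w => by simpa using e.map_adj_iff.symm) fun _ _ => rfl

lemma laplacianSpectrum_subset_of_iso {W : Type*} [Fintype W] {H : SimpleGraph W}
    [DecidableRel H.Adj] (e : G ≃g H) : laplacianSpectrum H ⊆ laplacianSpectrum G := by
  intro l hl
  obtain ⟨f, hf, h⟩ := mem_laplacianSpectrum_iff.1 hl
  refine mem_laplacianSpectrum_iff.2 ⟨f ∘ e, fun h0 => hf ?_, fun v => ?_⟩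
  · funext w
    simpa using congrFun h0 (e.symm w)
  · have := h (e v)
    rw [← sum_neighborFinset_iso e, e.degree_eq] at this
    exact this

lemma laplacianSpectrum_eq_of_iso {W : Type*} [Fintype W] {H : SimpleGraph W}
    [DecidableRel H.Adj] (e : G ≃g H) : laplacianSpectrum G = laplacianSpectrum H :=
  (laplacianSpectrum_subset_of_iso e.symm).antisymm (laplacianSpectrum_subset_of_iso e)

/-- The spectral theorem for the symmetric matrix `D^{-1/2} A D^{-1/2}`, which is similar to the
transition operator, turns a spectral gap into the variational inequality. -/
lemma hasWideGap_of_forall (hG : G.Connected) (hN : 3 ≤ Fintype.card V)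
    (h : ∀ l ∈ laplacianSpectrum G, 1 / 2 ≤ |1 - l|) : HasWideGap G := by
  classical
  refine ⟨hG, hN, fun f => ?_⟩
  have hd := degree_pos_of_connected hG hN
  set r : V → ℝ := fun v => √(G.degree v) with hr
  have hrpos : ∀ v, 0 < r v := fun v => Real.sqrt_pos.2 (by exact_mod_cast hd v)
  have hrsq : ∀ v, r v ^ 2 = G.degree v := fun v => Real.sq_sqrt (Nat.cast_nonneg _)
  set B : Matrix V V ℝ := Matrix.of fun u v => (r u)⁻¹ * (if G.Adj u v then (r v)⁻¹ else 0)
    with hB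
  have hBsymm : B.IsHermitian := by
    ext u v
    simp only [hB, Matrix.conjTranspose_apply, Matrix.of_apply, star_trivial, G.adj_comm v u]
    split_ifs <;> ring
  have hBmul : ∀ (x : V → ℝ) v,
      B.mulVec x v = (r v)⁻¹ * ∑ w ∈ G.neighborFinset v, (r w)⁻¹ * x w := by
    intro x v
    simp only [hB, Matrix.mulVec, dotProduct, Matrix.of_apply, mul_assoc, ite_mul, zero_mul]
    rw [← Finset.mul_sum, ← Finset.sum_filter, G.neighborFinset_eq_filter]
  set T := Matrix.toEuclideanLin B with hT
  have hTs : T.IsSymmetric := Matrix.isSymmetric_toEuclideanLin_iff.2 hBsymm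
  set b := hTs.eigenvectorBasis rfl
  have hev : ∀ i, 1 / 4 ≤ hTs.eigenvalues rfl i ^ 2 := by
    intro i
    have hTb : T (b i) = hTs.eigenvalues rfl i • b i := hTs.apply_eigenvectorBasis rfl i
    have hmem : 1 - hTs.eigenvalues rfl i ∈ laplacianSpectrum G := by
      refine mem_laplacianSpectrum_iff.2 ⟨fun v => (r v)⁻¹ * b i v, fun h0 => ?_, fun v => ?_⟩
      · refine b.orthonormal.ne_zero i ?_
        ext v
        have := congrFun h0 v
        simpa [(hrpos v).ne'] using this
      · have := congrArg (fun x : EuclideanSpace ℝ V => x v) hTb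
        simp only [hT, Matrix.toLpLin_apply, hBmul, PiLp.smul_apply, smul_eq_mul] at this
        rw [sub_sub_cancel, mul_left_comm, ← this, ← hrsq v]
        have := (hrpos v).ne'
        field_simp
    have := h _ hmem
    rw [sub_sub_cancel] at this
    rw [← sq_abs]
    nlinarith
  have hnorm : ∀ x : EuclideanSpace ℝ V, 1 / 4 * ‖x‖ ^ 2 ≤ ‖T x‖ ^ 2 := by
    intro x
    rw [← b.sum_sq_norm_inner_right x, ← b.sum_sq_norm_inner_right (T x), Finset.mul_sum]
    refine Finset.sum_le_sum fun i _ => ?_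
    rw [← hTs (b i) x, show T (b i) = hTs.eigenvalues rfl i • b i from
      hTs.apply_eigenvectorBasis rfl i, real_inner_smul_left, norm_mul, mul_pow,
      Real.norm_eq_abs (hTs.eigenvalues rfl i), sq_abs]
    exact mul_le_mul_of_nonneg_right (hev i) (sq_nonneg _)
  have hx := hnorm (WithLp.toLp 2 fun v => r v * f v)
  rw [EuclideanSpace.real_norm_sq_eq, EuclideanSpace.real_norm_sq_eq] at hx
  simp only [hT, Matrix.toLpLin_apply, hBmul, inv_mul_cancel_left₀ (hrpos _).ne'] at hx
  unfold twoStepForm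
  rw [sub_nonneg]
  refine le_trans (le_of_eq ?_) (hx.trans_eq ?_)
  · rw [Finset.mul_sum]
    refine Finset.sum_congr rfl fun v _ => ?_
    rw [mul_pow, hrsq]; ring
  · refine Finset.sum_congr rfl fun v _ => ?_
    rw [mul_pow, inv_pow, hrsq]; ring

end Spectrum

section ModelSpectrum

lemma degree_eq_of_neighborFinset_eq_pair {V : Type*} [Fintype V] [DecidableEq V]
    {G : SimpleGraph V} [DecidableRel G.Adj] {y u z : V} (huz : u ≠ z)
    (h : G.neighborFinset y = {u, z}) : G.degree y = 2 := by
  rw [← G.card_neighborFinset_eq_degree, h, Finset.card_pair huz]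

open scoped Classical in
lemma mem_laplacianSpectrum_petalGraph_iff {m : ℕ} {l : ℝ} :
    l ∈ laplacianSpectrum (petalGraph m) ↔ ∃ f : Unit ⊕ (Fin m ⊕ Fin m) → ℝ, f ≠ 0 ∧
      1 / (2 * m : ℝ) * ∑ i, (f (Sum.inr (Sum.inl i)) + f (Sum.inr (Sum.inr i))) =
        (1 - l) * f (Sum.inl ()) ∧
      (∀ i, 1 / 2 * (f (Sum.inl ()) + f (Sum.inr (Sum.inr i))) =
        (1 - l) * f (Sum.inr (Sum.inl i))) ∧
      ∀ i, 1 / 2 * (f (Sum.inl ()) + f (Sum.inr (Sum.inl i))) =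
        (1 - l) * f (Sum.inr (Sum.inr i)) := by
  have h1 : ∀ i : Fin m, (petalGraph m).neighborFinset (Sum.inr (Sum.inl i)) =
      {Sum.inl (), Sum.inr (Sum.inr i)} := fun i => by ext; simp [petalGraph_adj_left]
  have h2 : ∀ i : Fin m, (petalGraph m).neighborFinset (Sum.inr (Sum.inr i)) =
      {Sum.inl (), Sum.inr (Sum.inl i)} := fun i => by ext; simp [petalGraph_adj_right]
  have h0 : ∀ f : Unit ⊕ (Fin m ⊕ Fin m) → ℝ,
      ∑ w ∈ (petalGraph m).neighborFinset (Sum.inl ()), f w =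
        ∑ i, (f (Sum.inr (Sum.inl i)) + f (Sum.inr (Sum.inr i))) := fun f => by
    rw [SimpleGraph.neighborFinset_eq_filter, Finset.sum_filter]
    simp [petalGraph_adj_center, Finset.sum_add_distrib]
  have hd : ((petalGraph m).degree (Sum.inl ()) : ℝ) = 2 * m := by
    have := h0 fun _ => 1
    rw [Finset.sum_const, SimpleGraph.card_neighborFinset_eq_degree] at this
    norm_num at this
    linarith
  rw [mem_laplacianSpectrum_iff]
  refine exists_congr fun f => and_congr_right fun _ => ?_
  simp only [Sum.forall, h0, h1, h2, hd,
    degree_eq_of_neighborFinset_eq_pair Sum.inl_ne_inr (h1 _),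
    degree_eq_of_neighborFinset_eq_pair Sum.inl_ne_inr (h2 _),
    Finset.sum_pair (Sum.inl_ne_inr), Nat.cast_ofNat]
  exact and_congr_left fun _ => ⟨fun h => h (), fun h _ => h⟩

open scoped Classical in
lemma mem_laplacianSpectrum_bookGraph_iff {m : ℕ} {l : ℝ} :
    l ∈ laplacianSpectrum (bookGraph m) ↔ ∃ f : Fin 2 ⊕ (Fin m ⊕ Fin m) → ℝ, f ≠ 0 ∧
      1 / (m : ℝ) * ∑ i, f (Sum.inr (Sum.inl i)) = (1 - l) * f (Sum.inl 0) ∧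
      1 / (m : ℝ) * ∑ i, f (Sum.inr (Sum.inr i)) = (1 - l) * f (Sum.inl 1) ∧
      (∀ i, 1 / 2 * (f (Sum.inl 0) + f (Sum.inr (Sum.inr i))) =
        (1 - l) * f (Sum.inr (Sum.inl i))) ∧
      ∀ i, 1 / 2 * (f (Sum.inl 1) + f (Sum.inr (Sum.inl i))) =
        (1 - l) * f (Sum.inr (Sum.inr i)) := by
  have h1 : ∀ i : Fin m, (bookGraph m).neighborFinset (Sum.inr (Sum.inl i)) =
      {Sum.inl 0, Sum.inr (Sum.inr i)} := fun i => by ext; simp [bookGraph_adj_left]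
  have h2 : ∀ i : Fin m, (bookGraph m).neighborFinset (Sum.inr (Sum.inr i)) =
      {Sum.inl 1, Sum.inr (Sum.inl i)} := fun i => by ext; simp [bookGraph_adj_right]
  have hx : ∀ f : Fin 2 ⊕ (Fin m ⊕ Fin m) → ℝ,
      ∑ w ∈ (bookGraph m).neighborFinset (Sum.inl 0), f w = ∑ i, f (Sum.inr (Sum.inl i)) :=
    fun f => by
      rw [SimpleGraph.neighborFinset_eq_filter, Finset.sum_filter]
      simp [bookGraph_adj_left_hub]
  have hy : ∀ f : Fin 2 ⊕ (Fin m ⊕ Fin m) → ℝ,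
      ∑ w ∈ (bookGraph m).neighborFinset (Sum.inl 1), f w = ∑ i, f (Sum.inr (Sum.inr i)) :=
    fun f => by
      rw [SimpleGraph.neighborFinset_eq_filter, Finset.sum_filter]
      simp [bookGraph_adj_right_hub]
  have hdx : ((bookGraph m).degree (Sum.inl 0) : ℝ) = m := by
    have := hx fun _ => 1
    rw [Finset.sum_const, SimpleGraph.card_neighborFinset_eq_degree] at this
    simpa using this
  have hdy : ((bookGraph m).degree (Sum.inl 1) : ℝ) = m := by
    have := hy fun _ => 1
    rw [Finset.sum_const, SimpleGraph.card_neighborFinset_eq_degree] at this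
    simpa using this
  rw [mem_laplacianSpectrum_iff]
  refine exists_congr fun f => and_congr_right fun _ => ?_
  simp only [Sum.forall, Fin.forall_fin_two, hx, hy, h1, h2, hdx, hdy,
    degree_eq_of_neighborFinset_eq_pair Sum.inl_ne_inr (h1 _),
    degree_eq_of_neighborFinset_eq_pair Sum.inl_ne_inr (h2 _),
    Finset.sum_pair (Sum.inl_ne_inr), Nat.cast_ofNat, and_assoc]

open scoped Classical in
lemma half_le_of_mem_petalGraph {m : ℕ} (hm : 1 ≤ m) {l : ℝ}
    (hl : l ∈ laplacianSpectrum (petalGraph m)) : 1 / 2 ≤ |1 - l| := by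
  obtain ⟨f, hf, h0, h1, h2⟩ := mem_laplacianSpectrum_petalGraph_iff.1 hl
  by_contra hcon
  obtain ⟨hlo, hhi⟩ := abs_lt.1 (not_le.1 hcon)
  set μ := 1 - l
  have hm0 : (m : ℝ) ≠ 0 := by positivity
  have heq : ∀ i, f (Sum.inr (Sum.inl i)) = f (Sum.inr (Sum.inr i)) := fun i => by
    have : (μ + 1 / 2) * (f (Sum.inr (Sum.inl i)) - f (Sum.inr (Sum.inr i))) = 0 := by
      linear_combination h2 i - h1 i
    rcases mul_eq_zero.1 this with h | h <;> linarith
  have hv : ∀ i, (2 * μ - 1) * f (Sum.inr (Sum.inl i)) = f (Sum.inl ()) := fun i => by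
    have := h1 i
    rw [← heq i] at this
    linarith
  have hsum : (2 * μ - 1) * ∑ i : Fin m, (f (Sum.inr (Sum.inl i)) + f (Sum.inr (Sum.inr i))) =
      2 * m * f (Sum.inl ()) := by
    rw [Finset.mul_sum, Finset.sum_congr rfl fun i _ => show _ = 2 * f (Sum.inl ()) by
      rw [← heq i]; linear_combination 2 * hv i]
    simp; ring
  have hx : f (Sum.inl ()) = 0 := by
    have h0' : ∑ i : Fin m, (f (Sum.inr (Sum.inl i)) + f (Sum.inr (Sum.inr i))) =
        2 * m * (μ * f (Sum.inl ())) := by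
      rw [← h0]; field_simp
    rw [h0'] at hsum
    have h3 : (2 * m : ℝ) * ((2 * μ + 1) * ((μ - 1) * f (Sum.inl ()))) = 0 := by
      linear_combination hsum
    rcases mul_eq_zero.1 h3 with h | h
    · exact absurd h (by positivity)
    rcases mul_eq_zero.1 h with h | h
    · linarith
    rcases mul_eq_zero.1 h with h | h
    · linarith
    · exact h
  refine hf (funext ?_)
  have hv0 : ∀ i, f (Sum.inr (Sum.inl i)) = 0 := fun i => by
    have := hv i
    rw [hx] at this
    rcases mul_eq_zero.1 this with h | h
    · linarith
    · exact h
  rintro (_ | i | i)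
  · exact hx
  · exact hv0 i
  · exact (heq i).symm.trans (hv0 i)

open scoped Classical in
lemma half_le_of_mem_bookGraph {m : ℕ} (hm : 1 ≤ m) {l : ℝ}
    (hl : l ∈ laplacianSpectrum (bookGraph m)) : 1 / 2 ≤ |1 - l| := by
  obtain ⟨f, hf, hx, hy, h1, h2⟩ := mem_laplacianSpectrum_bookGraph_iff.1 hl
  by_contra hcon
  obtain ⟨hlo, hhi⟩ := abs_lt.1 (not_le.1 hcon)
  set μ := 1 - l
  have hm0 : (m : ℝ) ≠ 0 := by positivity
  have hμ : 4 * μ ^ 2 - 1 ≠ 0 := by nlinarith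
  have hv : ∀ i, (4 * μ ^ 2 - 1) * f (Sum.inr (Sum.inl i)) =
      2 * μ * f (Sum.inl 0) + f (Sum.inl 1) := fun i => by
    linear_combination -4 * μ * h1 i - 2 * h2 i
  have hw : ∀ i, (4 * μ ^ 2 - 1) * f (Sum.inr (Sum.inr i)) =
      2 * μ * f (Sum.inl 1) + f (Sum.inl 0) := fun i => by
    linear_combination -4 * μ * h2 i - 2 * h1 i
  have key : ∀ (g : Fin m → ℝ) (a c : ℝ), (∀ i, (4 * μ ^ 2 - 1) * g i = c) →
      1 / (m : ℝ) * ∑ i, g i = μ * a → (4 * μ ^ 2 - 1) * (μ * a) = c := by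
    intro g a c hg ha
    rw [← ha, mul_left_comm, Finset.mul_sum, Finset.sum_congr rfl fun i _ => hg i]
    simp [hm0]
  have hx' := key _ _ _ hv hx
  have hy' := key _ _ _ hw hy
  -- `4 μ³ - 3 μ` is the Chebyshev polynomial `T₃`, and `T₃ ^ 2 - 1 = (μ ^ 2 - 1) U₂ ^ 2`
  have hend : ∀ a c : ℝ, (4 * μ ^ 2 - 1) * (μ * a) = 2 * μ * a + c →
      (4 * μ ^ 2 - 1) * (μ * c) = 2 * μ * c + a → a = 0 := by
    intro a c h h'
    have h3 : (μ ^ 2 - 1) * ((4 * μ ^ 2 - 1) ^ 2 * a) = 0 := by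
      linear_combination (4 * μ ^ 3 - 3 * μ) * h + h'
    rcases mul_eq_zero.1 h3 with h | h
    · nlinarith
    · exact (mul_eq_zero.1 h).resolve_left (pow_ne_zero 2 hμ)
  have hx0 := hend _ _ hx' hy'
  have hy0 := hend _ _ hy' hx'
  refine hf (funext ?_)
  rintro (j | i | i)
  · fin_cases j
    exacts [hx0, hy0]
  · have := hv i
    rw [hx0, hy0] at this
    exact (mul_eq_zero.1 (by linarith)).resolve_left hμ
  · have := hw i
    rw [hx0, hy0] at this
    exact (mul_eq_zero.1 (by linarith)).resolve_left hμ

open scoped Classical in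
lemma three_halves_mem_petalGraph {m : ℕ} (hm : 1 ≤ m) :
    (3 / 2 : ℝ) ∈ laplacianSpectrum (petalGraph m) := by
  refine mem_laplacianSpectrum_petalGraph_iff.2
    ⟨Sum.elim 0 (Sum.elim 1 (-1)), fun h => ?_, ?_, fun i => ?_, fun i => ?_⟩
  · simpa using congrFun h (Sum.inr (Sum.inl ⟨0, hm⟩))
  all_goals norm_num

open scoped Classical in
lemma half_mem_petalGraph {m : ℕ} (hm : 2 ≤ m) :
    (1 / 2 : ℝ) ∈ laplacianSpectrum (petalGraph m) := by
  set c : Fin m → ℝ := Pi.single ⟨0, by omega⟩ 1 - Pi.single ⟨1, hm⟩ 1 with hc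
  refine mem_laplacianSpectrum_petalGraph_iff.2
    ⟨Sum.elim 0 (Sum.elim c c), fun h => ?_, ?_, fun i => ?_, fun i => ?_⟩
  · simpa [hc, Pi.single_apply, Fin.ext_iff] using congrFun h (Sum.inr (Sum.inl ⟨0, by omega⟩))
  · simp [hc, Finset.sum_add_distrib]
  all_goals norm_num

open scoped Classical in
lemma three_halves_mem_bookGraph {m : ℕ} (hm : 1 ≤ m) :
    (3 / 2 : ℝ) ∈ laplacianSpectrum (bookGraph m) := by
  have hm0 : (m : ℝ) ≠ 0 := by positivity
  refine mem_laplacianSpectrum_bookGraph_iff.2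
    ⟨Sum.elim ![2, 2] (Sum.elim (-1) (-1)), fun h => ?_, ?_, ?_, fun i => ?_, fun i => ?_⟩
  · simpa using congrFun h (Sum.inl 0)
  all_goals simp [hm0]; norm_num

open scoped Classical in
lemma half_mem_bookGraph {m : ℕ} (hm : 1 ≤ m) :
    (1 / 2 : ℝ) ∈ laplacianSpectrum (bookGraph m) := by
  have hm0 : (m : ℝ) ≠ 0 := by positivity
  refine mem_laplacianSpectrum_bookGraph_iff.2
    ⟨Sum.elim ![2, -2] (Sum.elim 1 (-1)), fun h => ?_, ?_, ?_, fun i => ?_, fun i => ?_⟩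
  · simpa using congrFun h (Sum.inl 0)
  all_goals simp [hm0]; norm_num

end ModelSpectrum

/-! ### The spectral gap and the maximal gap interval -/

section Gap

variable {V : Type*} [Fintype V] {G : SimpleGraph V} [DecidableRel G.Adj]

lemma isPetalGraph_or_isBookGraph_of_forall (hG : G.Connected) (hN : 3 ≤ Fintype.card V)
    (h : ∀ l ∈ laplacianSpectrum G, 1 / 2 ≤ |1 - l|) : IsPetalGraph G ∨ IsBookGraph G :=
  (hasWideGap_of_forall hG hN h).isPetalGraph_or_isBookGraph

lemma half_le_of_isPetalGraph_or_isBookGraph (h : IsPetalGraph G ∨ IsBookGraph G) {l : ℝ}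
    (hl : l ∈ laplacianSpectrum G) : 1 / 2 ≤ |1 - l| := by
  classical
  rcases h with ⟨m, hm, ⟨e⟩⟩ | ⟨m, hm, ⟨e⟩⟩ <;> rw [laplacianSpectrum_eq_of_iso e] at hl
  exacts [half_le_of_mem_petalGraph hm hl, half_le_of_mem_bookGraph hm hl]

lemma three_halves_mem_of_isPetalGraph_or_isBookGraph (h : IsPetalGraph G ∨ IsBookGraph G) :
    (3 / 2 : ℝ) ∈ laplacianSpectrum G := by
  classical
  rcases h with ⟨m, hm, ⟨e⟩⟩ | ⟨m, hm, ⟨e⟩⟩ <;> rw [laplacianSpectrum_eq_of_iso e]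
  exacts [three_halves_mem_petalGraph hm, three_halves_mem_bookGraph hm]

lemma IsPetalGraph.exists_card {V : Type*} [Fintype V] {G : SimpleGraph V}
    (h : IsPetalGraph G) :
    ∃ m, Fintype.card V = 2 * m + 1 ∧ Nonempty (G ≃g petalGraph m) := by
  obtain ⟨m, -, ⟨e⟩⟩ := h
  refine ⟨m, ?_, ⟨e⟩⟩
  rw [Fintype.card_congr e.toEquiv]
  simp; ring

lemma IsBookGraph.even_card {V : Type*} [Fintype V] {G : SimpleGraph V} (h : IsBookGraph G) : Even (Fintype.card V) := by
  obtain ⟨m, -, ⟨e⟩⟩ := h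
  refine ⟨m + 1, ?_⟩
  rw [Fintype.card_congr e.toEquiv]
  simp; ring

/-- Among the petal and book graphs only the triangle, which is the `1`-petal graph, lacks the
eigenvalue `½`. -/
lemma half_mem_of_isPetalGraph_or_isBookGraph (h : IsPetalGraph G ∨ IsBookGraph G)
    (hN : 4 ≤ Fintype.card V) : (1 / 2 : ℝ) ∈ laplacianSpectrum G := by
  classical
  rcases h with h | ⟨m, hm, ⟨e⟩⟩
  · obtain ⟨m, hm, ⟨e⟩⟩ := h.exists_card
    rw [laplacianSpectrum_eq_of_iso e]
    exact half_mem_petalGraph (by omega)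
  · rw [laplacianSpectrum_eq_of_iso e]
    exact half_mem_bookGraph hm

lemma isLeast_spectralGapFromOne (hG : G.Connected) (hN : 3 ≤ Fintype.card V) :
    IsLeast (distancesFromOne G) (spectralGapFromOne G) := by
  have hfin : (distancesFromOne G).Finite :=
    (Module.End.finite_hasEigenvalue (normalizedLaplacian G)).image _
  have hne : (distancesFromOne G).Nonempty := by
    -- the constant functions are eigenfunctions for the eigenvalue `0`
    refine ⟨_, 0, mem_laplacianSpectrum_iff.2 ⟨1, fun h => ?_, fun v => ?_⟩, rfl⟩
    · obtain ⟨v⟩ := hG.nonempty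
      simpa using congrFun h v
    · have := degree_pos_of_connected hG hN v
      simp [this.ne']
  exact ⟨hne.csInf_mem hfin, fun _ h => csInf_le hfin.bddBelow h⟩

lemma spectralGapFromOne_eq_half (hG : G.Connected) (hN : 3 ≤ Fintype.card V)
    (h : IsPetalGraph G ∨ IsBookGraph G) : spectralGapFromOne G = 1 / 2 := by
  obtain ⟨⟨l, hl, hle⟩, hmin⟩ := isLeast_spectralGapFromOne hG hN
  refine le_antisymm ?_ ?_
  · have := hmin ⟨3 / 2, three_halves_mem_of_isPetalGraph_or_isBookGraph h, rfl⟩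
    norm_num [abs_of_neg] at this ⊢
    exact this
  · rw [← hle]
    exact half_le_of_isPetalGraph_or_isBookGraph h hl

lemma isPetalGraph_or_isBookGraph_of_half_le (hG : G.Connected) (hN : 3 ≤ Fintype.card V)
    (h : 1 / 2 ≤ spectralGapFromOne G) : IsPetalGraph G ∨ IsBookGraph G :=
  isPetalGraph_or_isBookGraph_of_forall hG hN fun l hl =>
    h.trans ((isLeast_spectralGapFromOne hG hN).2 ⟨l, hl, rfl⟩)

lemma petalGraph_connected (m : ℕ) : (petalGraph m).Connected := by
  have h : ∀ t, (petalGraph m).Reachable (Sum.inl ()) t := by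
    rintro (⟨⟩ | i | i)
    · exact SimpleGraph.Reachable.refl _
    · exact ((petalGraph_adj_center m () _).2 ⟨i, Or.inl rfl⟩).reachable
    · exact ((petalGraph_adj_center m () _).2 ⟨i, Or.inr rfl⟩).reachable
  exact ⟨fun s t => (h s).symm.trans (h t)⟩

lemma mem_Ioo_iff_abs {l : ℝ} : l ∈ Set.Ioo (1 / 2 : ℝ) (3 / 2) ↔ |1 - l| < 1 / 2 := by
  rw [Set.mem_Ioo, abs_lt]
  constructor <;> rintro ⟨h1, h2⟩ <;> constructor <;> linarith

/-- The petal graphs witness that `(½, 3/2)` is a gap interval. -/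
lemma isGapInterval_Ioo : IsGapInterval connectedGraphs (Set.Ioo (1 / 2 : ℝ) (3 / 2)) := by
  classical
  refine ⟨isOpen_Ioo, Set.ordConnected_Ioo, ⟨1, by norm_num⟩, ?_⟩
  set Γ : ℕ → FiniteGraph := fun m =>
    ⟨Fintype.card (Unit ⊕ (Fin (m + 1) ⊕ Fin (m + 1))), (petalGraph (m + 1)).overFin rfl⟩ with hΓ
  have hcard : ∀ m, (Γ m).1 = 2 * m + 3 := fun m => by simp [hΓ]; ring
  refine ⟨Set.range Γ, ?_, Set.infinite_range_of_injective fun m n h => ?_, ?_, ?_⟩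
  · rintro _ ⟨m, rfl⟩
    exact ((petalGraph (m + 1)).overFinIso rfl).connected_iff.1 (petalGraph_connected _)
  · have := congrArg Sigma.fst h
    rw [hcard, hcard] at this
    omega
  · rintro _ ⟨m, rfl⟩ _ ⟨n, rfl⟩ hne
    refine ⟨fun e => hne ?_⟩
    have := Fintype.card_congr e.toEquiv
    rw [Fintype.card_fin, Fintype.card_fin, hcard, hcard] at this
    rw [show m = n by omega]
  · rintro _ ⟨m, rfl⟩
    rw [Set.disjoint_left]
    intro l hl
    rw [mem_Ioo_iff_abs, not_lt]
    exact half_le_of_isPetalGraph_or_isBookGraph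
      (Or.inl ⟨m + 1, by omega, ⟨((petalGraph (m + 1)).overFinIso rfl).symm⟩⟩) hl

lemma exists_le_card_of_infinite {S : Set FiniteGraph} (hS : S.Infinite) (n : ℕ) :
    ∃ Γ ∈ S, n ≤ Γ.1 := by
  by_contra! h
  refine hS ((Set.finite_range
    (fun p : Σ k : Fin n, SimpleGraph (Fin k) => (⟨p.1, p.2⟩ : FiniteGraph))).subset ?_)
  intro Γ hΓ
  exact ⟨⟨⟨Γ.1, h Γ hΓ⟩, Γ.2⟩, rfl⟩

lemma subset_Ioo_of_isGapInterval {I : Set ℝ} (hI : IsGapInterval connectedGraphs I)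
    (hsub : Set.Ioo (1 / 2 : ℝ) (3 / 2) ⊆ I) : I ⊆ Set.Ioo (1 / 2 : ℝ) (3 / 2) := by
  classical
  obtain ⟨-, hconn, -, S, hS, hinf, -, hdisj⟩ := hI
  obtain ⟨⟨n, H⟩, hΓ, hn⟩ := exists_le_card_of_infinite hinf 4
  have hd := Set.disjoint_left.1 (hdisj _ hΓ)
  have hn' : 4 ≤ Fintype.card (Fin n) := by simpa using hn
  have hpb : IsPetalGraph H ∨ IsBookGraph H :=
    isPetalGraph_or_isBookGraph_of_forall (hS hΓ) (by omega) fun l hl => by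
      by_contra hcon
      exact hd hl (hsub (mem_Ioo_iff_abs.2 (not_le.1 hcon)))
  have h1 : (1 : ℝ) ∈ I := hsub (by norm_num)
  intro z hz
  by_contra hcon
  rw [Set.mem_Ioo, not_and_or, not_lt, not_lt] at hcon
  rcases hcon with h | h
  · exact hd (half_mem_of_isPetalGraph_or_isBookGraph hpb hn')
      (hconn.out hz h1 ⟨h, by norm_num⟩)
  · exact hd (three_halves_mem_of_isPetalGraph_or_isBookGraph hpb)
      (hconn.out h1 hz ⟨by norm_num, h⟩)

end Gap

theorem theorem1 :
    (∀ (V : Type*) [Fintype V] (G : SimpleGraph V) [DecidableRel G.Adj],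
      G.Connected → 3 ≤ Fintype.card V →
        IsLeast (distancesFromOne G) (spectralGapFromOne G) ∧
        spectralGapFromOne G ≤ 1 / 2 ∧
        (spectralGapFromOne G = 1 / 2 ↔
          (Odd (Fintype.card V) ∧ IsPetalGraph G) ∨ (Even (Fintype.card V) ∧ IsBookGraph G))) ∧
    Maximal (IsGapInterval connectedGraphs) (Set.Ioo (1 / 2 : ℝ) (3 / 2)) := by
  refine ⟨fun V _ G _ hG hN => ⟨isLeast_spectralGapFromOne hG hN, ?_, fun h => ?_, fun h => ?_⟩,
    isGapInterval_Ioo, fun I hI hsub => subset_Ioo_of_isGapInterval hI hsub⟩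
  · rcases le_total (1 / 2) (spectralGapFromOne G) with h | h
    · exact (spectralGapFromOne_eq_half hG hN
        (isPetalGraph_or_isBookGraph_of_half_le hG hN h)).le
    · exact h
  · refine (isPetalGraph_or_isBookGraph_of_half_le hG hN h.ge).imp (fun hp => ⟨?_, hp⟩)
      fun hb => ⟨hb.even_card, hb⟩
    obtain ⟨m, hm, -⟩ := hp.exists_card
    exact ⟨m, hm⟩
  · exact spectralGapFromOne_eq_half hG hN (h.imp And.right And.right)
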